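/- **Model.** An agent has a normal prior with mean $\omega_0\in\mathbb R$ and variance $\sigma_0^2>0$ and density $\mu_0$ on the state $\omega\in\mathbb R$. Given $\omega$, a signal $s$ has density $f(s|\omega)=h f_H(s|\omega)+(1-h)f_L(s|\omega)$, where $h\in[0,1]$ and $f_q(\cdot|\omega)$ is the normal density with mean $\omega$ and variance $\sigma_q^2>0$, $q\in\{H,L\}$. The agent chooses a radius $r\in[0,\infty]$ and observes a signal with density $$T_rf(s|\omega)=\frac{f(s|\omega)}{\int_{\omega_0-r}^{\omega_0+r}f(t|\omega)\,dt}\ \text{ for } |s-\omega_0|<r,\qquad T_rf(s|\omega)=0\ \text{ otherwise}$$ ($T_\infty f=f$; for $r=0$ the signal is $\omega_0$ and nothing is learned). After the signal $s$ she takes the action equal to the posterior expected state, $$a^\star(s,r)=\frac{\int\omega\,T_rf(s|\omega)\mu_0(\omega)\,d\omega}{\int T_rf(s|\omega)\mu_0(\omega)\,d\omega}\quad(r>0),\qquad a^\star(s,0)=\omega_0 .$$ A radius $r^\star\in[0,\infty]$ is *optimal* if it minimizes over $r\in[0,\infty]$ the expected loss $$\int\Bigl(\int_{\omega_0-r}^{\omega_0+r}(\omega-a^\star(s,r))^2\,T_rf(s|\omega)\,ds\Bigr)\mu_0(\omega)\,d\omega$$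 (which is understood as $\int(\omega-\omega_0)^2\mu_0(\omega)\,d\omega=\sigma_0^2$ for $r=0$). **Proposition.** Fix $\omega_0$ and $\sigma_0^2>0$, and let $\sigma_H^2>0$, $\sigma_L^2>0$ and $h\in[0,1]$ vary (along a sequence, or any filter) in such a way that $\sigma_H^2$ and $\sigma_L^2$ have limits in $(0,\infty)$ (for instance, are constant), and that $|\sigma_H^2-\sigma_L^2|\to0$ or $h\to0$ or $h\to1$. Then: 1. For all parameters along the family an optimal radius $r^\star\in[0,\infty]$ exists. 2. There are $b\in\mathbb R$ and $c>0$ such that, for every choice of optimal radii $r^\star$, one has $r^\star\to\infty$ and, for every $s\in\mathbb R$, $a^\star(s,r^\star)\to b+cs$; also $a^\star(s,\infty)\to b+cs$ for every $s$. 3. Whenever there is no quality uncertainty, that is, $\sigma_H^2=\sigma_L^2$ or $h\in\{0,1\}$, the radius $r=\infty$ (no censoring) is optimal, and it is the only optimal radius. -/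

import Mathlib

open MeasureTheory ProbabilityTheory Filter Topology
open scoped NNReal ENNReal

noncomputable section

namespace EchoChamber

/-! ### The sampling model for a prior density `μ₀` and signal densities `f s ω` given the state `ω` -/

/-- The signals at distance less than `r ∈ [0, ∞]` from `ω₀`: the interval `(ω₀ - r, ω₀ + r)` for
finite `r`, and the whole real line for `r = ∞`. -/
def signalRange (ω₀ : ℝ) (r : ℝ≥0∞) : Set ℝ :=
  {s | ENNReal.ofReal |s - ω₀| < r}

open Classical in
/-- The truncated signal density `T_r f (s | ω)`: for each state `ω`, the density `f (· | ω)`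
restricted to the signal range and divided by the probability
`F (ω₀ + r | ω) - F (ω₀ - r | ω) = ∫ t in (ω₀ - r, ω₀ + r), f (t | ω)` of that range. For `r = ∞`
the signal is not truncated. -/
def truncDensity (ω₀ : ℝ) (r : ℝ≥0∞) (f : ℝ → ℝ → ℝ) (s ω : ℝ) : ℝ :=
  if r = ⊤ then f s ω
  else if s ∈ signalRange ω₀ r then f s ω / ∫ t in signalRange ω₀ r, f t ω
  else 0

/-- The posterior density `μ₁ (ω | s, r)` of the state. For `r = 0` the signal is `ω₀` whatever the
state, so that nothing is learned and the posterior is the prior. -/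
def posteriorDensity (ω₀ : ℝ) (μ₀ : ℝ → ℝ) (f : ℝ → ℝ → ℝ) (r : ℝ≥0∞) (s ω : ℝ) : ℝ :=
  if r = 0 then μ₀ ω
  else truncDensity ω₀ r f s ω * μ₀ ω / ∫ ω', truncDensity ω₀ r f s ω' * μ₀ ω'

/-- The action `a⋆ (s, r)` taken after the signal `s`: the posterior expectation of the state. -/
def action (ω₀ : ℝ) (μ₀ : ℝ → ℝ) (f : ℝ → ℝ → ℝ) (s : ℝ) (r : ℝ≥0∞) : ℝ :=
  ∫ ω, ω * posteriorDensity ω₀ μ₀ f r s ω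

/-- The expected loss (minus the expected utility) of the radius `r`,
`∫ (∫ (ω - a⋆ (s, r))² T_r f (s | ω) ds) μ₀ (ω) dω`, as an element of `[0, ∞]`. For `r = 0` the
signal is the constant `ω₀`, with no density, and the inner integral is the value at `s = ω₀`. -/
def expectedLoss (ω₀ : ℝ) (μ₀ : ℝ → ℝ) (f : ℝ → ℝ → ℝ) (r : ℝ≥0∞) : ℝ≥0∞ :=
  if r = 0 then
    ∫⁻ ω, ENNReal.ofReal ((ω - action ω₀ μ₀ f ω₀ 0) ^ 2) * ENNReal.ofReal (μ₀ ω)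
  else
    ∫⁻ ω, (∫⁻ s in signalRange ω₀ r,
      ENNReal.ofReal ((ω - action ω₀ μ₀ f s r) ^ 2 * truncDensity ω₀ r f s ω))
        * ENNReal.ofReal (μ₀ ω)

/-! ### Normal prior and normal signals -/

/-- Parameters of the model: prior mean, prior variance, variances of the high-type and of the
low-type signals, and the share of high-type sources. -/
structure NormalParams where
  ω₀ : ℝ
  v₀ : ℝ≥0
  vH : ℝ≥0
  vL : ℝ≥0
  h : ℝ

namespace NormalParams

/-- The prior density: normal with mean `ω₀` and variance `v₀`. -/
def prior (P : NormalParams) (ω : ℝ) : ℝ := gaussianPDFReal P.ω₀ P.v₀ ω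

/-- The density of a signal `s` given the state `ω`: a mixture of two normal densities with mean
`ω`. -/
def signal (P : NormalParams) (s ω : ℝ) : ℝ :=
  P.h * gaussianPDFReal ω P.vH s + (1 - P.h) * gaussianPDFReal ω P.vL s

/-- The optimal action `a⋆ (s, r)`. -/
def optAction (P : NormalParams) (s : ℝ) (r : ℝ≥0∞) : ℝ :=
  action P.ω₀ P.prior P.signal s r

/-- The radius `r ∈ [0, ∞]` minimizes the expected loss among all radii in `[0, ∞]`. -/
def IsOptimalRadius (P : NormalParams) (r : ℝ≥0∞) : Prop :=
  ∀ r' : ℝ≥0∞,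
    expectedLoss P.ω₀ P.prior P.signal r ≤ expectedLoss P.ω₀ P.prior P.signal r'

end NormalParams

end EchoChamber

end

/-!
Write `J` for the joint density of the state and of a normal signal of variance `v`, truncated at a
finite radius. Its score `∂ log J / ∂ ω` is `(s - m(ω)) / v - (ω - ω₀) / v₀`, where `m(ω)` is the
mean of the truncated signal. Truncation makes the variance of the signal smaller than `v`, so the
Fisher information is less than `1 / v₀ + 1 / v`, and the Bayesian Cramér–Rao inequality bounds the
loss strictly from below by `v₀ v / (v₀ + v)`. A linear decision rule attains this value without
censoring; hence `r = ∞` is the only optimum when there is no quality uncertainty.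

For general signals the loss is lower semicontinuous jointly in the signal and in `r ∈ [0, ∞]`: by
Scheffé's lemma and Fatou's lemma for positive limits of the radii, and for radii tending to `0`
because the likelihoods become flat on the observed range. Compactness of `[0, ∞]` gives existence.
When the quality uncertainty vanishes, the losses of optimal radii are at most those of a linear
rule, which tend to `v₀ v / (v₀ + v)`, so that a cluster point of the radii can only be `∞`.

Dominated convergence needs a countably generated filter; a given filter is first enlarged to such
a filter along which the parameters still converge.
-/

noncomputable section

namespace EchoChamber

lemma ofReal_integral_le_lintegral_ofReal {α : Type*} {_ : MeasurableSpace α} {μ : Measure α}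
    {f : α → ℝ} (hf : Integrable f μ) :
    ENNReal.ofReal (∫ x, f x ∂μ) ≤ ∫⁻ x, ENNReal.ofReal (f x) ∂μ := by
  calc ENNReal.ofReal (∫ x, f x ∂μ) ≤ ENNReal.ofReal (∫ x, max (f x) 0 ∂μ) :=
        ENNReal.ofReal_le_ofReal (integral_mono hf hf.pos_part fun x => le_max_left _ _)
    _ = ∫⁻ x, ENNReal.ofReal (max (f x) 0) ∂μ :=
        ofReal_integral_eq_lintegral_ofReal hf.pos_part (ae_of_all _ fun x => le_max_right _ _)
    _ = ∫⁻ x, ENNReal.ofReal (f x) ∂μ := by simp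

lemma integral_lt_integral_of_lt {α : Type*} {_ : MeasurableSpace α} {μ : Measure α} [NeZero μ]
    {f g : α → ℝ} (hf : Integrable f μ) (hg : Integrable g μ) (hfg : ∀ x, f x < g x) :
    ∫ x, f x ∂μ < ∫ x, g x ∂μ := by
  have hsupp : Function.support (fun x => g x - f x) = Set.univ :=
    Set.eq_univ_of_forall fun x => (sub_pos.2 (hfg x)).ne'
  rw [← sub_pos, ← integral_sub hg hf, integral_pos_iff_support_of_nonneg
    (fun x => (sub_pos.2 (hfg x)).le) (hg.sub hf), hsupp]
  exact Measure.measure_univ_pos.2 (NeZero.ne μ)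

section MeanSquaredError

lemma integral_sub_sq_mul_eq {w : ℝ → ℝ} (h0 : Integrable w) (h1 : Integrable fun x => x * w x)
    (h2 : Integrable fun x => x ^ 2 * w x) (c : ℝ) :
    ∫ x, (x - c) ^ 2 * w x = (∫ x, x ^ 2 * w x) - 2 * c * (∫ x, x * w x) + c ^ 2 * ∫ x, w x := by
  have h3 : Integrable fun x => x ^ 2 * w x - 2 * c * (x * w x) := h2.sub (h1.const_mul _)
  rw [← integral_const_mul, ← integral_const_mul, ← integral_sub h2 (h1.const_mul _),
    ← integral_add h3 (h0.const_mul _)]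
  exact integral_congr_ae (ae_of_all _ fun x => by ring)

lemma integral_sub_mean_sq_mul_le {w : ℝ → ℝ} (hw : 0 < ∫ x, w x)
    (h0 : Integrable w) (h1 : Integrable fun x => x * w x) (h2 : Integrable fun x => x ^ 2 * w x)
    (d : ℝ) :
    ∫ x, (x - (∫ y, y * w y) / ∫ y, w y) ^ 2 * w x ≤ ∫ x, (x - d) ^ 2 * w x := by
  rw [integral_sub_sq_mul_eq h0 h1 h2, integral_sub_sq_mul_eq h0 h1 h2]
  set D := ∫ y, w y
  set N := ∫ y, y * w y
  have hgap : (d ^ 2 * D - 2 * d * N) - ((N / D) ^ 2 * D - 2 * (N / D) * N)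
      = (d - N / D) ^ 2 * D := by
    field_simp
    ring
  have : 0 ≤ (d - N / D) ^ 2 * D := by positivity
  linarith

lemma lintegral_sub_sq_mul_le_of_symm {w : ℝ → ℝ} (hw : Measurable w) (hw0 : ∀ x, 0 ≤ w x)
    {c : ℝ} (hsymm : ∀ x, w (2 * c - x) = w x) (a : ℝ) :
    ∫⁻ x, ENNReal.ofReal ((x - c) ^ 2 * w x) ≤ ∫⁻ x, ENNReal.ofReal ((x - a) ^ 2 * w x) := by
  have hmeas (b : ℝ) : Measurable fun x => ENNReal.ofReal ((x - b) ^ 2 * w x) := by fun_prop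
  have hreflect : ∫⁻ x, ENNReal.ofReal ((2 * c - x - a) ^ 2 * w x)
      = ∫⁻ x, ENNReal.ofReal ((x - a) ^ 2 * w x) := by
    rw [← lintegral_sub_left_eq_self (fun x => ENNReal.ofReal ((x - a) ^ 2 * w x)) (2 * c)]
    simp only [hsymm]
  refine (ENNReal.mul_le_mul_iff_right two_ne_zero ENNReal.ofNat_ne_top).1 ?_
  calc 2 * ∫⁻ x, ENNReal.ofReal ((x - c) ^ 2 * w x)
      = ∫⁻ x, ENNReal.ofReal (2 * ((x - c) ^ 2 * w x)) := by
        rw [← lintegral_const_mul _ (hmeas c)]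
        simp only [ENNReal.ofReal_mul zero_le_two, ENNReal.ofReal_ofNat]
    _ ≤ ∫⁻ x, (ENNReal.ofReal ((x - a) ^ 2 * w x)
          + ENNReal.ofReal ((2 * c - x - a) ^ 2 * w x)) := by
        refine lintegral_mono fun x => ?_
        have hx := hw0 x
        rw [← ENNReal.ofReal_add (by positivity) (by positivity)]
        refine ENNReal.ofReal_le_ofReal ?_
        nlinarith [mul_nonneg (sq_nonneg (c - a)) hx]
    _ = 2 * ∫⁻ x, ENNReal.ofReal ((x - a) ^ 2 * w x) := by
        rw [lintegral_add_left (hmeas a), hreflect, two_mul]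

end MeanSquaredError

section Limits

variable {ι α : Type*} {_ : MeasurableSpace α} {μ : Measure α} {l : Filter ι}
  [l.IsCountablyGenerated] {F : ι → α → ℝ} {f : α → ℝ}

-- Scheffé's lemma: `|F - f| = F - f + 2 (f - F)⁺`, and `(f - F)⁺` is dominated by `|f|`.
lemma tendsto_integral_abs_sub_of_nonneg (hF : ∀ i, Integrable (F i) μ) (hf : Integrable f μ)
    (hF0 : ∀ i, 0 ≤ F i) (hlim : ∀ᵐ x ∂μ, Tendsto (fun i => F i x) l (𝓝 (f x)))
    (hint : Tendsto (fun i => ∫ x, F i x ∂μ) l (𝓝 (∫ x, f x ∂μ))) :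
    Tendsto (fun i => ∫ x, |F i x - f x| ∂μ) l (𝓝 0) := by
  have hpos (i : ι) : Integrable (fun x => max (f x - F i x) 0) μ := (hf.sub (hF i)).pos_part
  have hdom : Tendsto (fun i => ∫ x, max (f x - F i x) 0 ∂μ) l (𝓝 (∫ _, 0 ∂μ)) := by
    refine tendsto_integral_filter_of_dominated_convergence (fun x => |f x|)
      (.of_forall fun i => (hpos i).aestronglyMeasurable)
      (.of_forall fun i => ae_of_all _ fun x => ?_) hf.abs ?_
    · rw [Real.norm_of_nonneg (le_max_right _ _)]
      exact max_le ((sub_le_self _ (hF0 i x)).trans (le_abs_self _)) (abs_nonneg _)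
    · filter_upwards [hlim] with x hx
      simpa using (hx.const_sub (f x)).max (tendsto_const_nhds (x := (0 : ℝ)))
  have hsplit (i : ι) : ∫ x, |F i x - f x| ∂μ
      = ((∫ x, F i x ∂μ) - ∫ x, f x ∂μ) + 2 * ∫ x, max (f x - F i x) 0 ∂μ := by
    have hsub : Integrable (fun x => F i x - f x) μ := (hF i).sub hf
    rw [← integral_sub (hF i) hf, ← integral_const_mul, ← integral_add hsub ((hpos i).const_mul 2)]
    congr 1 with x
    rcases le_total (f x) (F i x) with h | h
    · simp [h]
    · rw [abs_sub_comm, abs_of_nonneg (sub_nonneg.2 h), max_eq_left (sub_nonneg.2 h)]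
      ring
  simpa [hsplit] using (hint.sub_const (∫ x, f x ∂μ)).add (hdom.const_mul 2)

lemma tendsto_setIntegral_of_tendsto_integral_abs_sub {A : ι → Set α} {A' : Set α}
    (hF : ∀ i, Integrable (F i) μ) (hf : Integrable f μ)
    (hA : ∀ i, MeasurableSet (A i)) (hA' : MeasurableSet A')
    (hlim : Tendsto (fun i => ∫ x, |F i x - f x| ∂μ) l (𝓝 0))
    (hmem : ∀ᵐ x ∂μ, ∀ᶠ i in l, x ∈ A i ↔ x ∈ A') :
    Tendsto (fun i => ∫ x in A i, F i x ∂μ) l (𝓝 (∫ x in A', f x ∂μ)) := by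
  have hset : Tendsto (fun i => ∫ x in A i, f x ∂μ) l (𝓝 (∫ x in A', f x ∂μ)) := by
    simp only [← integral_indicator hA']
    simp only [← integral_indicator (hA _)]
    refine tendsto_integral_filter_of_dominated_convergence (fun x => |f x|)
      (.of_forall fun i => (hf.indicator (hA i)).aestronglyMeasurable)
      (.of_forall fun i => ae_of_all _ fun x => norm_indicator_le_norm_self _ _) hf.abs ?_
    filter_upwards [hmem] with x hx
    refine tendsto_const_nhds.congr' ?_
    filter_upwards [hx] with i hi
    by_cases h : x ∈ A' <;> simp [h, hi]
  have hdiff : Tendsto (fun i => ∫ x in A i, (F i x - f x) ∂μ) l (𝓝 0) := by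
    refine squeeze_zero_norm (fun i => ?_) hlim
    exact (norm_integral_le_integral_norm _).trans
      (setIntegral_le_integral ((hF i).sub hf).norm (ae_of_all _ fun x => norm_nonneg _))
  simpa [integral_sub (hF _).integrableOn hf.integrableOn] using hdiff.add hset

end Limits

section VanTrees

variable {w S : ℝ → ℝ} {a : ℝ}

lemma integrable_mul_mul_of_sq {α : Type*} {_ : MeasurableSpace α} {μ : Measure α}
    {g h w : α → ℝ} (hw : 0 ≤ w) (hmeas : AEStronglyMeasurable (fun x => g x * (h x * w x)) μ)
    (hg : Integrable (fun x => g x ^ 2 * w x) μ) (hh : Integrable (fun x => h x ^ 2 * w x) μ) :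
    Integrable (fun x => g x * (h x * w x)) μ := by
  refine (hg.add hh).mono' hmeas (ae_of_all _ fun x => ?_)
  rw [Pi.add_apply, ← add_mul, ← mul_assoc, norm_mul, Real.norm_of_nonneg (hw x)]
  refine mul_le_mul_of_nonneg_right ?_ (hw x)
  rw [Real.norm_eq_abs, abs_le]
  constructor <;> nlinarith [sq_nonneg (g x + h x), sq_nonneg (g x - h x)]

lemma integrable_sub_mul_score (hw : 0 ≤ w) (hderiv : ∀ x, HasDerivAt w (S x * w x) x)
    (h2 : Integrable fun x => (x - a) ^ 2 * w x) (hS : Integrable fun x => S x ^ 2 * w x) :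
    Integrable fun x => (x - a) * (S x * w x) := by
  have hdw : deriv w = fun x => S x * w x := funext fun x => (hderiv x).deriv
  refine integrable_mul_mul_of_sq hw (AEStronglyMeasurable.mul (by fun_prop) ?_) h2 hS
  exact hdw ▸ (measurable_deriv w).aestronglyMeasurable

lemma integral_sub_mul_score (hw : 0 ≤ w) (hderiv : ∀ x, HasDerivAt w (S x * w x) x)
    (h0 : Integrable w) (h2 : Integrable fun x => (x - a) ^ 2 * w x)
    (hS : Integrable fun x => S x ^ 2 * w x) :
    ∫ x, (x - a) * (S x * w x) = -∫ x, w x := by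
  have h1 : Integrable fun x => (x - a) * (1 * w x) :=
    integrable_mul_mul_of_sq hw (AEStronglyMeasurable.mul (by fun_prop)
      (by simpa using h0.aestronglyMeasurable)) h2 (by simpa using h0)
  have hcross := integrable_sub_mul_score hw hderiv h2 hS
  have hprod (x : ℝ) : HasDerivAt (fun x => (x - a) * w x) (w x + (x - a) * (S x * w x)) x := by
    simpa only [one_mul] using ((hasDerivAt_id' x).sub_const a).fun_mul (hderiv x)
  have hzero := integral_eq_zero_of_hasDerivAt_of_integrable hprod (h0.add hcross)
    (by simpa using h1)
  rw [integral_add h0 hcross] at hzero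
  linarith

-- Expand `0 ≤ ∫ ((x - a) + k S)² w` and integrate the cross term by parts.
lemma le_integral_sub_sq_mul_of_score (hw : 0 ≤ w) (hderiv : ∀ x, HasDerivAt w (S x * w x) x)
    (h0 : Integrable w) (h2 : Integrable fun x => (x - a) ^ 2 * w x)
    (hS : Integrable fun x => S x ^ 2 * w x) (k : ℝ) :
    2 * k * (∫ x, w x) - k ^ 2 * ∫ x, S x ^ 2 * w x ≤ ∫ x, (x - a) ^ 2 * w x := by
  have hcross := integrable_sub_mul_score hw hderiv h2 hS
  have hexpand : ∫ x, ((x - a) + k * S x) ^ 2 * w x = (∫ x, (x - a) ^ 2 * w x)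
      + 2 * k * (∫ x, (x - a) * (S x * w x)) + k ^ 2 * ∫ x, S x ^ 2 * w x := by
    have hsum : Integrable fun x => (x - a) ^ 2 * w x + 2 * k * ((x - a) * (S x * w x)) :=
      h2.add (hcross.const_mul _)
    rw [← integral_const_mul, ← integral_const_mul, ← integral_add h2 (hcross.const_mul _),
      ← integral_add hsum (hS.const_mul _)]
    exact integral_congr_ae (ae_of_all _ fun x => by ring)
  have hnonneg : 0 ≤ ∫ x, ((x - a) + k * S x) ^ 2 * w x :=
    integral_nonneg fun x => mul_nonneg (sq_nonneg _) (hw x)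
  rw [hexpand, integral_sub_mul_score hw hderiv h0 h2 hS] at hnonneg
  linarith

lemma ofReal_le_lintegral_sub_sq_mul_of_score (hw : 0 ≤ w)
    (hderiv : ∀ x, HasDerivAt w (S x * w x) x) (h0 : Integrable w)
    (hS : Integrable fun x => S x ^ 2 * w x) (a k : ℝ) :
    ENNReal.ofReal (2 * k * (∫ x, w x) - k ^ 2 * ∫ x, S x ^ 2 * w x)
      ≤ ∫⁻ x, ENNReal.ofReal ((x - a) ^ 2 * w x) := by
  have hnonneg (x : ℝ) : 0 ≤ (x - a) ^ 2 * w x := mul_nonneg (sq_nonneg _) (hw x)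
  by_cases h2 : Integrable fun x => (x - a) ^ 2 * w x
  · rw [← ofReal_integral_eq_lintegral_ofReal h2 (ae_of_all _ hnonneg)]
    exact ENNReal.ofReal_le_ofReal (le_integral_sub_sq_mul_of_score hw hderiv h0 h2 hS k)
  · have hmeas : AEStronglyMeasurable fun x => (x - a) ^ 2 * w x :=
      AEStronglyMeasurable.mul (by fun_prop) h0.aestronglyMeasurable
    have htop : ∫⁻ x, ENNReal.ofReal ((x - a) ^ 2 * w x) = ⊤ := by
      by_contra h
      exact h2 ⟨hmeas, (hasFiniteIntegral_iff_ofReal (ae_of_all _ hnonneg)).2 (Ne.lt_top h)⟩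
    exact htop ▸ le_top

-- The van Trees inequality (Bayesian Cramér–Rao bound), with `k` in place of the reciprocal of
-- the Fisher information.
theorem ofReal_le_lintegral_lintegral_sub_sq_mul_of_score {α : Type*} {_ : MeasurableSpace α}
    {ν : Measure α} [SFinite ν] {w S : α → ℝ → ℝ} (hw : ∀ s, 0 ≤ w s)
    (hderiv : ∀ᵐ s ∂ν, ∀ x, HasDerivAt (w s) (S s x * w s x) x)
    (h0 : Integrable (fun p : α × ℝ => w p.1 p.2) (ν.prod volume))
    (hS : Integrable (fun p : α × ℝ => S p.1 p.2 ^ 2 * w p.1 p.2) (ν.prod volume))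
    (d : α → ℝ) (k : ℝ) :
    ENNReal.ofReal (2 * k * (∫ s, (∫ x, w s x) ∂ν) - k ^ 2 * ∫ s, (∫ x, S s x ^ 2 * w s x) ∂ν)
      ≤ ∫⁻ s, (∫⁻ x, ENNReal.ofReal ((x - d s) ^ 2 * w s x)) ∂ν := by
  have h0' : Integrable (fun s => 2 * k * ∫ x, w s x) ν := h0.integral_prod_left.const_mul _
  have hS' : Integrable (fun s => k ^ 2 * ∫ x, S s x ^ 2 * w s x) ν :=
    hS.integral_prod_left.const_mul _
  rw [← integral_const_mul, ← integral_const_mul, ← integral_sub h0' hS']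
  refine (ofReal_integral_le_lintegral_ofReal (h0'.sub hS')).trans (lintegral_mono_ae ?_)
  filter_upwards [hderiv, h0.prod_right_ae, hS.prod_right_ae] with s hs h0s hSs
  exact ofReal_le_lintegral_sub_sq_mul_of_score (hw s) hs h0s hSs (d s) k

end VanTrees

section SignalRange

variable {ω₀ s ρ : ℝ} {r r' : ℝ≥0∞}

lemma mem_signalRange : s ∈ signalRange ω₀ r ↔ ENNReal.ofReal |s - ω₀| < r := Iff.rfl

lemma mem_signalRange_ofReal : s ∈ signalRange ω₀ (ENNReal.ofReal ρ) ↔ |s - ω₀| < ρ := by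
  rw [mem_signalRange, ENNReal.ofReal_lt_ofReal_iff']
  exact and_iff_left_of_imp (abs_nonneg _).trans_lt

@[simp] lemma signalRange_top : signalRange ω₀ ⊤ = Set.univ := by
  ext s; simp [signalRange]

lemma signalRange_ofReal : signalRange ω₀ (ENNReal.ofReal ρ) = Set.Ioo (ω₀ - ρ) (ω₀ + ρ) := by
  ext s
  rw [mem_signalRange_ofReal, abs_sub_lt_iff, Set.mem_Ioo, sub_lt_iff_lt_add', sub_lt_comm,
    and_comm]

lemma measurableSet_signalRange (ω₀ : ℝ) (r : ℝ≥0∞) : MeasurableSet (signalRange ω₀ r) :=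
  measurableSet_lt (by fun_prop) measurable_const

lemma isOpen_signalRange (ω₀ : ℝ) (r : ℝ≥0∞) : IsOpen (signalRange ω₀ r) :=
  isOpen_lt (ENNReal.continuous_ofReal.comp (by fun_prop)) continuous_const

lemma signalRange_mono (h : r ≤ r') : signalRange ω₀ r ⊆ signalRange ω₀ r' :=
  fun _ hs => lt_of_lt_of_le hs h

lemma ne_zero_of_mem_signalRange (hs : s ∈ signalRange ω₀ r) : r ≠ 0 :=
  (bot_le.trans_lt hs).ne'

lemma volume_signalRange_pos (hr : r ≠ 0) : 0 < volume (signalRange ω₀ r) :=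
  (isOpen_signalRange ω₀ r).measure_pos volume
    ⟨ω₀, by simpa [mem_signalRange] using pos_iff_ne_zero.2 hr⟩

lemma exists_radius_of_mem_signalRange (hs : s ∈ signalRange ω₀ r) :
    ∃ ρ : ℝ, |s - ω₀| < ρ ∧ ENNReal.ofReal ρ < r := by
  obtain ⟨x, hsx, hxr⟩ := exists_between (mem_signalRange.1 hs)
  lift x to ℝ≥0 using hxr.ne_top
  refine ⟨x, ?_, by simpa using hxr⟩
  simpa using (ENNReal.ofReal_lt_iff_lt_toReal (abs_nonneg _) ENNReal.coe_ne_top).1 hsx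

lemma ae_ofReal_dist_ne (ω₀ : ℝ) (r : ℝ≥0∞) : ∀ᵐ s : ℝ, ENNReal.ofReal |s - ω₀| ≠ r := by
  have hfin : ({ω₀ + r.toReal, ω₀ - r.toReal} : Set ℝ).Finite := by simp
  filter_upwards [hfin.countable.ae_notMem volume] with s hs heq
  have habs : |s - ω₀| = r.toReal := by rw [← heq, ENNReal.toReal_ofReal (abs_nonneg _)]
  rcases abs_eq_abs.1 (habs.trans (abs_of_nonneg ENNReal.toReal_nonneg).symm) with h | h
  · exact hs (Or.inl (by linarith))
  · exact hs (Or.inr (show s = _ by linarith))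

lemma eventually_mem_signalRange {ι : Type*} {l : Filter ι} {r : ι → ℝ≥0∞}
    (hr : Tendsto r l (𝓝 r')) (hs : s ∈ signalRange ω₀ r') :
    ∀ᶠ i in l, s ∈ signalRange ω₀ (r i) :=
  hr.eventually_const_lt hs

lemma eventually_mem_signalRange_iff {ι : Type*} {l : Filter ι} {r : ι → ℝ≥0∞}
    (hr : Tendsto r l (𝓝 r')) (hs : ENNReal.ofReal |s - ω₀| ≠ r') :
    ∀ᶠ i in l, (s ∈ signalRange ω₀ (r i) ↔ s ∈ signalRange ω₀ r') := by
  rcases hs.lt_or_gt with h | h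
  · filter_upwards [eventually_mem_signalRange hr h] with i hi using iff_of_true hi h
  · filter_upwards [hr.eventually_lt_const h] with i hi using iff_of_false hi.not_gt h.not_gt

end SignalRange

section TruncatedSignal

/-- Positive, jointly measurable conditional densities `f s ω` of a signal `s` given a state `ω`. -/
structure IsSignalDensity (f : ℝ → ℝ → ℝ) : Prop where
  measurable : Measurable fun p : ℝ × ℝ => f p.1 p.2
  pos : ∀ s ω, 0 < f s ω
  integral_eq_one : ∀ ω, ∫ s, f s ω = 1

/-- Signals within distance `ρ` of `ω₀` have likelihoods comparable up to a factor that grows at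
most exponentially in the state. Normal densities have this property, uniformly for variances
bounded away from `0`; it dominates all the integrands over the state. -/
def ExpComparable (ω₀ κ : ℝ) (f : ℝ → ℝ → ℝ) : Prop :=
  ∀ ⦃ρ s t : ℝ⦄, |s - ω₀| ≤ ρ → |t - ω₀| ≤ ρ →
    ∀ ω, f t ω ≤ f s ω * Real.exp (κ * ρ * (ρ + |ω - ω₀|))

/-- The probability of a signal in the range of radius `r` given the state `ω`. -/
def rangeMass (ω₀ : ℝ) (r : ℝ≥0∞) (f : ℝ → ℝ → ℝ) (ω : ℝ) : ℝ :=
  ∫ t in signalRange ω₀ r, f t ω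

variable {ω₀ κ ρ s : ℝ} {r r' : ℝ≥0∞} {f : ℝ → ℝ → ℝ}

lemma IsSignalDensity.integrable (hf : IsSignalDensity f) (ω : ℝ) : Integrable fun s => f s ω :=
  .of_integral_ne_zero (by simp [hf.integral_eq_one])

lemma IsSignalDensity.rangeMass_top (hf : IsSignalDensity f) (ω : ℝ) : rangeMass ω₀ ⊤ f ω = 1 := by
  simp [rangeMass, hf.integral_eq_one]

lemma IsSignalDensity.rangeMass_pos (hf : IsSignalDensity f) (hr : r ≠ 0) (ω : ℝ) :
    0 < rangeMass ω₀ r f ω := by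
  rw [rangeMass, setIntegral_pos_iff_support_of_nonneg_ae (ae_of_all _ fun s => (hf.pos s ω).le)
    (hf.integrable ω).integrableOn]
  have hsupp : Function.support (fun s => f s ω) = Set.univ :=
    Set.eq_univ_of_forall fun s => (hf.pos s ω).ne'
  simpa [hsupp] using volume_signalRange_pos hr

lemma IsSignalDensity.rangeMass_mono (hf : IsSignalDensity f) (h : r ≤ r') (ω : ℝ) :
    rangeMass ω₀ r f ω ≤ rangeMass ω₀ r' f ω :=
  setIntegral_mono_set (hf.integrable ω).integrableOn (ae_of_all _ fun s => (hf.pos s ω).le)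
    (signalRange_mono h).eventuallyLE

lemma IsSignalDensity.measurable_rangeMass (hf : IsSignalDensity f) :
    Measurable (rangeMass ω₀ r f) := by
  have h : StronglyMeasurable (Function.uncurry fun ω t => f t ω) :=
    (hf.measurable.comp measurable_swap).stronglyMeasurable
  exact (h.integral_prod_right (ν := volume.restrict (signalRange ω₀ r))).measurable

lemma IsSignalDensity.truncDensity_of_mem (hf : IsSignalDensity f) (hs : s ∈ signalRange ω₀ r)
    (ω : ℝ) : truncDensity ω₀ r f s ω = f s ω / rangeMass ω₀ r f ω := by
  unfold truncDensity
  split_ifs with h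
  · rw [h, hf.rangeMass_top, div_one]
  · rfl

lemma truncDensity_of_notMem (hs : s ∉ signalRange ω₀ r) (ω : ℝ) :
    truncDensity ω₀ r f s ω = 0 := by
  rw [truncDensity, if_neg (by rintro rfl; simp at hs), if_neg hs]

lemma IsSignalDensity.truncDensity_pos (hf : IsSignalDensity f) (hs : s ∈ signalRange ω₀ r)
    (ω : ℝ) : 0 < truncDensity ω₀ r f s ω := by
  rw [hf.truncDensity_of_mem hs]
  exact div_pos (hf.pos s ω) (hf.rangeMass_pos (ne_zero_of_mem_signalRange hs) ω)

lemma IsSignalDensity.truncDensity_nonneg (hf : IsSignalDensity f) (r : ℝ≥0∞) (s ω : ℝ) :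
    0 ≤ truncDensity ω₀ r f s ω := by
  by_cases hs : s ∈ signalRange ω₀ r
  · exact (hf.truncDensity_pos hs ω).le
  · exact (truncDensity_of_notMem hs ω).ge

lemma IsSignalDensity.measurable_truncDensity (hf : IsSignalDensity f) :
    Measurable fun p : ℝ × ℝ => truncDensity ω₀ r f p.1 p.2 := by
  have h : (fun p : ℝ × ℝ => truncDensity ω₀ r f p.1 p.2) =
      (Prod.fst ⁻¹' signalRange ω₀ r).indicator fun p => f p.1 p.2 / rangeMass ω₀ r f p.2 := by
    ext p
    by_cases hp : p.1 ∈ signalRange ω₀ r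
    · rw [Set.indicator_of_mem (by exact hp), hf.truncDensity_of_mem hp]
    · rw [Set.indicator_of_notMem (by exact hp), truncDensity_of_notMem hp]
  rw [h]
  exact (hf.measurable.div (hf.measurable_rangeMass.comp measurable_snd)).indicator
    (measurable_fst (measurableSet_signalRange _ _))

lemma IsSignalDensity.setIntegral_truncDensity (hf : IsSignalDensity f) (hr : r ≠ 0) (ω : ℝ) :
    ∫ s in signalRange ω₀ r, truncDensity ω₀ r f s ω = 1 := by
  rw [setIntegral_congr_fun (measurableSet_signalRange _ _) fun s hs => hf.truncDensity_of_mem hs ω,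
    integral_div]
  exact div_self (hf.rangeMass_pos hr ω).ne'

lemma setIntegral_const_signalRange_ofReal (hρ : 0 ≤ ρ) (c : ℝ) :
    ∫ _ in signalRange ω₀ (ENNReal.ofReal ρ), c = c * (2 * ρ) := by
  rw [signalRange_ofReal, setIntegral_const, Real.volume_real_Ioo_of_le (by linarith), smul_eq_mul]
  ring

lemma integrableOn_const_signalRange_ofReal (c : ℝ) :
    IntegrableOn (fun _ => c) (signalRange ω₀ (ENNReal.ofReal ρ)) := by
  rw [signalRange_ofReal]
  exact integrableOn_const (by simp)

lemma ExpComparable.mul_le_rangeMass (hκ : ExpComparable ω₀ κ f) (hf : IsSignalDensity f)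
    (hs : |s - ω₀| ≤ ρ) (ω : ℝ) :
    f s ω * (2 * ρ)
      ≤ rangeMass ω₀ (ENNReal.ofReal ρ) f ω * Real.exp (κ * ρ * (ρ + |ω - ω₀|)) := by
  rw [← setIntegral_const_signalRange_ofReal ((abs_nonneg _).trans hs), rangeMass,
    ← integral_mul_const]
  exact setIntegral_mono_on (integrableOn_const_signalRange_ofReal _)
    ((hf.integrable ω).mul_const _).integrableOn (measurableSet_signalRange _ _)
    fun t ht => hκ (mem_signalRange_ofReal.1 ht).le hs ω

lemma ExpComparable.rangeMass_le (hκ : ExpComparable ω₀ κ f) (hf : IsSignalDensity f)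
    (hs : |s - ω₀| ≤ ρ) (ω : ℝ) :
    rangeMass ω₀ (ENNReal.ofReal ρ) f ω
      ≤ f s ω * Real.exp (κ * ρ * (ρ + |ω - ω₀|)) * (2 * ρ) := by
  rw [← setIntegral_const_signalRange_ofReal ((abs_nonneg _).trans hs)]
  exact setIntegral_mono_on (hf.integrable ω).integrableOn
    (integrableOn_const_signalRange_ofReal _) (measurableSet_signalRange _ _)
    fun t ht => hκ hs (mem_signalRange_ofReal.1 ht).le ω

lemma ExpComparable.truncDensity_le (hκ : ExpComparable ω₀ κ f) (hf : IsSignalDensity f)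
    (hρ : 0 < ρ) (hr : ENNReal.ofReal ρ ≤ r) (hs : |s - ω₀| ≤ ρ) (ω : ℝ) :
    truncDensity ω₀ r f s ω ≤ Real.exp (κ * ρ * (ρ + |ω - ω₀|)) / (2 * ρ) := by
  by_cases hsr : s ∈ signalRange ω₀ r
  · rw [hf.truncDensity_of_mem hsr, div_le_div_iff₀
      (hf.rangeMass_pos (ne_zero_of_mem_signalRange hsr) ω) (by positivity), mul_comm (Real.exp _)]
    exact (hκ.mul_le_rangeMass hf hs ω).trans
      (mul_le_mul_of_nonneg_right (hf.rangeMass_mono hr ω) (Real.exp_pos _).le)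
  · rw [truncDensity_of_notMem hsr]
    positivity

lemma ExpComparable.le_truncDensity (hκ : ExpComparable ω₀ κ f) (hf : IsSignalDensity f)
    (hs : |s - ω₀| < ρ) (ω : ℝ) :
    Real.exp (-(κ * ρ * (ρ + |ω - ω₀|))) / (2 * ρ)
      ≤ truncDensity ω₀ (ENNReal.ofReal ρ) f s ω := by
  have hρ : 0 < ρ := (abs_nonneg _).trans_lt hs
  rw [hf.truncDensity_of_mem (mem_signalRange_ofReal.2 hs), Real.exp_neg, inv_eq_one_div, div_div,
    div_le_div_iff₀ (by positivity) (hf.rangeMass_pos (by simpa using hρ) ω)]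
  simpa only [one_mul, mul_assoc] using hκ.rangeMass_le hf hs.le ω

end TruncatedSignal

section ExpGrowth

/-- Measurable functions that grow at most exponentially, measured from the point `c`; such
functions of the state have finite posterior means. -/
structure ExpGrowth (c : ℝ) (φ : ℝ → ℝ) : Prop where
  measurable : Measurable φ
  bound : ∃ C k, ∀ x, |φ x| ≤ C * Real.exp (k * |x - c|)

variable {c : ℝ} {φ ψ : ℝ → ℝ}

lemma ExpGrowth.const (a : ℝ) : ExpGrowth c fun _ => a :=
  ⟨measurable_const, |a|, 0, by simp⟩

lemma ExpGrowth.sub_const (a : ℝ) : ExpGrowth c fun x => x - a := by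
  refine ⟨by fun_prop, 1 + |c - a|, 1, fun x => ?_⟩
  calc |x - a| ≤ |x - c| + |c - a| := abs_sub_le _ _ _
    _ ≤ (1 + |c - a|) * (|x - c| + 1) := by
      nlinarith [abs_nonneg (x - c), mul_nonneg (abs_nonneg (x - c)) (abs_nonneg (c - a))]
    _ ≤ (1 + |c - a|) * Real.exp (1 * |x - c|) := by
      rw [one_mul]
      gcongr
      exact Real.add_one_le_exp _

lemma ExpGrowth.id : ExpGrowth c fun x => x := by
  simpa using ExpGrowth.sub_const (c := c) 0

lemma ExpGrowth.mul (hφ : ExpGrowth c φ) (hψ : ExpGrowth c ψ) : ExpGrowth c fun x => φ x * ψ x := by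
  obtain ⟨C, k, hC⟩ := hφ.bound
  obtain ⟨D, m, hD⟩ := hψ.bound
  refine ⟨hφ.measurable.mul hψ.measurable, C * D, k + m, fun x => ?_⟩
  rw [abs_mul, add_mul, Real.exp_add, mul_mul_mul_comm]
  exact mul_le_mul (hC x) (hD x) (abs_nonneg _) ((abs_nonneg _).trans (hC x))

lemma ExpGrowth.sub_sq (a : ℝ) : ExpGrowth c fun x => (x - a) ^ 2 := by
  simpa only [sq] using (ExpGrowth.sub_const a).mul (ExpGrowth.sub_const a)

end ExpGrowth

section Posterior

/-- Positive prior densities that are symmetric about `ω₀` and have all exponential moments. -/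
structure IsTamePrior (ω₀ : ℝ) (μ₀ : ℝ → ℝ) : Prop where
  measurable : Measurable μ₀
  pos : ∀ ω, 0 < μ₀ ω
  integral_eq_one : ∫ ω, μ₀ ω = 1
  symm : ∀ ω, μ₀ (2 * ω₀ - ω) = μ₀ ω
  integrable_exp : ∀ c, Integrable fun ω => Real.exp (c * |ω - ω₀|) * μ₀ ω

/-- The joint density of the truncated signal and the state. -/
def jointDensity (ω₀ : ℝ) (μ₀ : ℝ → ℝ) (f : ℝ → ℝ → ℝ) (r : ℝ≥0∞) (s ω : ℝ) : ℝ :=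
  truncDensity ω₀ r f s ω * μ₀ ω

variable {ω₀ κ ρ s : ℝ} {r : ℝ≥0∞} {μ₀ : ℝ → ℝ} {f : ℝ → ℝ → ℝ} {φ : ℝ → ℝ}

lemma IsTamePrior.integrable_mul (hμ : IsTamePrior ω₀ μ₀) (hφ : ExpGrowth ω₀ φ) :
    Integrable fun ω => φ ω * μ₀ ω := by
  obtain ⟨C, c, hC⟩ := hφ.bound
  refine ((hμ.integrable_exp c).const_mul C).mono'
    (hφ.measurable.mul hμ.measurable).aestronglyMeasurable (ae_of_all _ fun ω => ?_)
  rw [norm_mul, Real.norm_of_nonneg (hμ.pos ω).le, ← mul_assoc]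
  exact mul_le_mul_of_nonneg_right (hC ω) (hμ.pos ω).le

lemma IsTamePrior.integral_sub_mul (hμ : IsTamePrior ω₀ μ₀) : ∫ ω, (ω - ω₀) * μ₀ ω = 0 := by
  have hodd : ∫ ω, (ω - ω₀) * μ₀ ω = -∫ ω, (ω - ω₀) * μ₀ ω := by
    nth_rewrite 1 [← integral_sub_left_eq_self (fun ω => (ω - ω₀) * μ₀ ω) volume (2 * ω₀)]
    rw [← integral_neg]
    congr 1 with ω
    rw [hμ.symm]
    ring
  linarith

lemma IsTamePrior.integral_mul_self (hμ : IsTamePrior ω₀ μ₀) : ∫ ω, ω * μ₀ ω = ω₀ := by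
  have hsplit : ∫ ω, (ω - ω₀) * μ₀ ω = (∫ ω, ω * μ₀ ω) - ∫ ω, ω₀ * μ₀ ω := by
    rw [← integral_sub (hμ.integrable_mul .id) (hμ.integrable_mul (.const ω₀))]
    simp only [sub_mul]
  rw [hμ.integral_sub_mul, integral_const_mul, hμ.integral_eq_one] at hsplit
  linarith

lemma jointDensity_of_notMem (hs : s ∉ signalRange ω₀ r) (ω : ℝ) :
    jointDensity ω₀ μ₀ f r s ω = 0 := by
  rw [jointDensity, truncDensity_of_notMem hs, zero_mul]

lemma jointDensity_pos (hμ : IsTamePrior ω₀ μ₀) (hf : IsSignalDensity f)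
    (hs : s ∈ signalRange ω₀ r) (ω : ℝ) : 0 < jointDensity ω₀ μ₀ f r s ω :=
  mul_pos (hf.truncDensity_pos hs ω) (hμ.pos ω)

lemma jointDensity_nonneg (hμ : IsTamePrior ω₀ μ₀) (hf : IsSignalDensity f) (r : ℝ≥0∞)
    (s ω : ℝ) : 0 ≤ jointDensity ω₀ μ₀ f r s ω :=
  mul_nonneg (hf.truncDensity_nonneg r s ω) (hμ.pos ω).le

lemma measurable_jointDensity (hμ : IsTamePrior ω₀ μ₀) (hf : IsSignalDensity f) :
    Measurable fun p : ℝ × ℝ => jointDensity ω₀ μ₀ f r p.1 p.2 :=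
  hf.measurable_truncDensity.mul (hμ.measurable.comp measurable_snd)

lemma measurable_jointDensity_right (hμ : IsTamePrior ω₀ μ₀) (hf : IsSignalDensity f) (s : ℝ) :
    Measurable (jointDensity ω₀ μ₀ f r s) :=
  (measurable_jointDensity hμ hf).comp (measurable_prodMk_left (x := s))

lemma jointDensity_le (hμ : IsTamePrior ω₀ μ₀) (hf : IsSignalDensity f)
    (hκ : ExpComparable ω₀ κ f) (hρ : 0 < ρ) (hr : ENNReal.ofReal ρ ≤ r) (hs : |s - ω₀| ≤ ρ)
    (ω : ℝ) :
    jointDensity ω₀ μ₀ f r s ω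
      ≤ Real.exp (κ * ρ * ρ) / (2 * ρ) * (Real.exp (κ * ρ * |ω - ω₀|) * μ₀ ω) := by
  refine (mul_le_mul_of_nonneg_right (hκ.truncDensity_le hf hρ hr hs ω) (hμ.pos ω).le).trans_eq ?_
  rw [mul_add, Real.exp_add]
  ring

lemma ExpGrowth.exists_integrable_bound (hφ : ExpGrowth ω₀ φ) (hμ : IsTamePrior ω₀ μ₀) (κ : ℝ)
    (hρ : 0 < ρ) :
    ∃ b : ℝ → ℝ, Integrable b ∧ ∀ f, IsSignalDensity f → ExpComparable ω₀ κ f →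
      ∀ r, ENNReal.ofReal ρ ≤ r → ∀ s, |s - ω₀| ≤ ρ →
        ∀ ω, ‖φ ω * jointDensity ω₀ μ₀ f r s ω‖ ≤ b ω := by
  obtain ⟨C, c, hC⟩ := hφ.bound
  refine ⟨_, ((hμ.integrable_exp (c + κ * ρ)).const_mul (C * (Real.exp (κ * ρ * ρ) / (2 * ρ)))),
    fun f hf hκ r hr s hs ω => ?_⟩
  rw [norm_mul, Real.norm_of_nonneg (jointDensity_nonneg hμ hf r s ω), add_mul, Real.exp_add]
  refine (mul_le_mul (hC ω) (jointDensity_le hμ hf hκ hρ hr hs ω)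
    (jointDensity_nonneg hμ hf r s ω) ((abs_nonneg _).trans (hC ω))).trans_eq ?_
  ring

lemma ExpGrowth.integrable_mul_jointDensity (hφ : ExpGrowth ω₀ φ) (hμ : IsTamePrior ω₀ μ₀)
    (hf : IsSignalDensity f) (hκ : ExpComparable ω₀ κ f) (hs : s ∈ signalRange ω₀ r) :
    Integrable fun ω => φ ω * jointDensity ω₀ μ₀ f r s ω := by
  obtain ⟨ρ, hsρ, hρr⟩ := exists_radius_of_mem_signalRange hs
  obtain ⟨b, hb, hle⟩ := hφ.exists_integrable_bound hμ κ ((abs_nonneg _).trans_lt hsρ)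
  exact hb.mono' (hφ.measurable.mul (measurable_jointDensity_right hμ hf s)).aestronglyMeasurable
    (ae_of_all _ (hle f hf hκ r hρr.le s hsρ.le))

lemma integrable_jointDensity (hμ : IsTamePrior ω₀ μ₀) (hf : IsSignalDensity f)
    (hκ : ExpComparable ω₀ κ f) (hs : s ∈ signalRange ω₀ r) :
    Integrable (jointDensity ω₀ μ₀ f r s) := by
  simpa using (ExpGrowth.const 1).integrable_mul_jointDensity hμ hf hκ hs

lemma integral_jointDensity_pos (hμ : IsTamePrior ω₀ μ₀) (hf : IsSignalDensity f)
    (hκ : ExpComparable ω₀ κ f) (hs : s ∈ signalRange ω₀ r) :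
    0 < ∫ ω, jointDensity ω₀ μ₀ f r s ω := by
  rw [integral_pos_iff_support_of_nonneg (jointDensity_nonneg hμ hf r s)
    (integrable_jointDensity hμ hf hκ hs)]
  have hsupp : Function.support (jointDensity ω₀ μ₀ f r s) = Set.univ :=
    Set.eq_univ_of_forall fun ω => (jointDensity_pos hμ hf hs ω).ne'
  simp [hsupp]

lemma action_eq_div (hr : r ≠ 0) (s : ℝ) :
    action ω₀ μ₀ f s r
      = (∫ ω, ω * jointDensity ω₀ μ₀ f r s ω) / ∫ ω, jointDensity ω₀ μ₀ f r s ω := by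
  rw [action, ← integral_div]
  simp only [posteriorDensity, if_neg hr, jointDensity, mul_div_assoc]

lemma action_zero (hμ : IsTamePrior ω₀ μ₀) (s : ℝ) : action ω₀ μ₀ f s 0 = ω₀ := by
  simp only [action, posteriorDensity, if_true, hμ.integral_mul_self]

lemma measurable_action (hμ : IsTamePrior ω₀ μ₀) (hf : IsSignalDensity f) :
    Measurable fun s => action ω₀ μ₀ f s r := by
  rcases eq_or_ne r 0 with rfl | hr
  · simp only [action_zero hμ, measurable_const]
  simp only [action_eq_div hr]
  have hj := measurable_jointDensity (r := r) hμ hf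
  have hN : StronglyMeasurable (Function.uncurry fun s ω => ω * jointDensity ω₀ μ₀ f r s ω) :=
    (measurable_snd.mul hj).stronglyMeasurable
  have hD : StronglyMeasurable (Function.uncurry fun s ω => jointDensity ω₀ μ₀ f r s ω) :=
    hj.stronglyMeasurable
  exact hN.integral_prod_right.measurable.div hD.integral_prod_right.measurable

lemma integrable_jointDensity_prod (hμ : IsTamePrior ω₀ μ₀) (hf : IsSignalDensity f)
    (hr : r ≠ 0) : Integrable (fun p : ℝ × ℝ => jointDensity ω₀ μ₀ f r p.1 p.2)
      ((volume.restrict (signalRange ω₀ r)).prod volume) := by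
  have hnorm (s ω : ℝ) : ‖jointDensity ω₀ μ₀ f r s ω‖ = jointDensity ω₀ μ₀ f r s ω :=
    Real.norm_of_nonneg (jointDensity_nonneg hμ hf r s ω)
  rw [integrable_prod_iff' (measurable_jointDensity hμ hf).aestronglyMeasurable]
  simp only [hnorm]
  simp only [jointDensity, integral_mul_const, hf.setIntegral_truncDensity hr, one_mul]
  refine ⟨ae_of_all _ fun ω => ?_, .of_integral_ne_zero (by simp [hμ.integral_eq_one])⟩
  exact (Integrable.of_integral_ne_zero (by simp [hf.setIntegral_truncDensity hr])).mul_const _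

lemma integral_integral_jointDensity (hμ : IsTamePrior ω₀ μ₀) (hf : IsSignalDensity f)
    (hr : r ≠ 0) : ∫ s in signalRange ω₀ r, ∫ ω, jointDensity ω₀ μ₀ f r s ω = 1 := by
  rw [integral_integral_swap (integrable_jointDensity_prod hμ hf hr)]
  simp only [jointDensity, integral_mul_const, hf.setIntegral_truncDensity hr, one_mul,
    hμ.integral_eq_one]

end Posterior

section ExpectedLoss

variable {ω₀ κ ρ s : ℝ} {r : ℝ≥0∞} {μ₀ : ℝ → ℝ} {f : ℝ → ℝ → ℝ}

lemma measurable_sub_sq_mul_jointDensity (hμ : IsTamePrior ω₀ μ₀) (hf : IsSignalDensity f)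
    {d : ℝ → ℝ} (hd : Measurable d) : Measurable fun p : ℝ × ℝ =>
      ENNReal.ofReal ((p.2 - d p.1) ^ 2 * jointDensity ω₀ μ₀ f r p.1 p.2) :=
  (((measurable_snd.sub (hd.comp measurable_fst)).pow_const 2).mul
    (measurable_jointDensity hμ hf)).ennreal_ofReal

lemma expectedLoss_eq_lintegral (hμ : IsTamePrior ω₀ μ₀) (hf : IsSignalDensity f) (hr : r ≠ 0) :
    expectedLoss ω₀ μ₀ f r = ∫⁻ s, ∫⁻ ω,
      ENNReal.ofReal ((ω - action ω₀ μ₀ f s r) ^ 2 * jointDensity ω₀ μ₀ f r s ω) := by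
  rw [expectedLoss, if_neg hr, lintegral_lintegral_swap
    (measurable_sub_sq_mul_jointDensity hμ hf (measurable_action hμ hf)).aemeasurable]
  refine lintegral_congr fun ω => ?_
  rw [← lintegral_mul_const' _ _ ENNReal.ofReal_ne_top,
    ← lintegral_indicator (measurableSet_signalRange _ _)]
  refine lintegral_congr fun s => ?_
  by_cases hs : s ∈ signalRange ω₀ r
  · rw [Set.indicator_of_mem hs, ← ENNReal.ofReal_mul' (hμ.pos ω).le, mul_assoc, jointDensity]
  · simp [hs, jointDensity_of_notMem hs]

lemma expectedLoss_le (hμ : IsTamePrior ω₀ μ₀) (hf : IsSignalDensity f)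
    (hκ : ExpComparable ω₀ κ f) (hr : r ≠ 0) (d : ℝ → ℝ) :
    expectedLoss ω₀ μ₀ f r
      ≤ ∫⁻ s, ∫⁻ ω, ENNReal.ofReal ((ω - d s) ^ 2 * jointDensity ω₀ μ₀ f r s ω) := by
  rw [expectedLoss_eq_lintegral hμ hf hr]
  refine lintegral_mono fun s => ?_
  by_cases hs : s ∈ signalRange ω₀ r
  swap
  · simp [jointDensity_of_notMem hs]
  have hint (c : ℝ) : Integrable fun ω => (ω - c) ^ 2 * jointDensity ω₀ μ₀ f r s ω :=
    (ExpGrowth.sub_sq c).integrable_mul_jointDensity hμ hf hκ hs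
  have hnonneg (c : ℝ) : 0 ≤ᵐ[volume] fun ω => (ω - c) ^ 2 * jointDensity ω₀ μ₀ f r s ω :=
    ae_of_all _ fun ω => mul_nonneg (sq_nonneg _) (jointDensity_nonneg hμ hf r s ω)
  rw [← ofReal_integral_eq_lintegral_ofReal (hint _) (hnonneg _),
    ← ofReal_integral_eq_lintegral_ofReal (hint _) (hnonneg _), action_eq_div hr]
  exact ENNReal.ofReal_le_ofReal (integral_sub_mean_sq_mul_le
    (integral_jointDensity_pos hμ hf hκ hs) (integrable_jointDensity hμ hf hκ hs)
    (ExpGrowth.id.integrable_mul_jointDensity hμ hf hκ hs) (by simpa using hint 0) _)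

lemma expectedLoss_zero (hμ : IsTamePrior ω₀ μ₀) :
    expectedLoss ω₀ μ₀ f 0 = ∫⁻ ω, ENNReal.ofReal ((ω - ω₀) ^ 2 * μ₀ ω) := by
  simp only [expectedLoss, if_true, action_zero hμ, ENNReal.ofReal_mul (sq_nonneg _)]

/-- The part of the joint density that survives, up to the factor `2 * ρ`, after every likelihood
is replaced by the lower bound from `ExpComparable`; for small `ρ` it is close to the prior. -/
def dampedPrior (ω₀ κ : ℝ) (μ₀ : ℝ → ℝ) (ρ ω : ℝ) : ℝ :=
  Real.exp (-(κ * ρ * (ρ + |ω - ω₀|))) * μ₀ ω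

lemma measurable_dampedPrior (hμ : IsTamePrior ω₀ μ₀) : Measurable (dampedPrior ω₀ κ μ₀ ρ) :=
  Measurable.mul (by fun_prop) hμ.measurable

lemma tendsto_dampedPrior (ω : ℝ) :
    Tendsto (fun ρ => dampedPrior ω₀ κ μ₀ ρ ω) (𝓝 0) (𝓝 (μ₀ ω)) := by
  have hcont : Continuous fun ρ => dampedPrior ω₀ κ μ₀ ρ ω := by
    unfold dampedPrior
    fun_prop
  simpa [dampedPrior] using hcont.tendsto 0

lemma inv_mul_dampedPrior_le_jointDensity (hμ : IsTamePrior ω₀ μ₀) (hf : IsSignalDensity f)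
    (hκ : ExpComparable ω₀ κ f) (hs : |s - ω₀| < ρ) (ω : ℝ) :
    (2 * ρ)⁻¹ * dampedPrior ω₀ κ μ₀ ρ ω ≤ jointDensity ω₀ μ₀ f (ENNReal.ofReal ρ) s ω := by
  rw [dampedPrior, jointDensity, ← mul_assoc, inv_mul_eq_div]
  exact mul_le_mul_of_nonneg_right (hκ.le_truncDensity hf hs ω) (hμ.pos ω).le

-- The lower bound is symmetric about `ω₀`, so that no action does better against it than `ω₀`.
lemma mul_lintegral_dampedPrior_le (hμ : IsTamePrior ω₀ μ₀) (hf : IsSignalDensity f)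
    (hκ : ExpComparable ω₀ κ f) (hs : |s - ω₀| < ρ) (a : ℝ) :
    ENNReal.ofReal (2 * ρ)⁻¹ * ∫⁻ ω, ENNReal.ofReal ((ω - ω₀) ^ 2 * dampedPrior ω₀ κ μ₀ ρ ω)
      ≤ ∫⁻ ω, ENNReal.ofReal ((ω - a) ^ 2 * jointDensity ω₀ μ₀ f (ENNReal.ofReal ρ) s ω) := by
  have hρ : 0 < ρ := (abs_nonneg _).trans_lt hs
  have hsymm (ω : ℝ) : dampedPrior ω₀ κ μ₀ ρ (2 * ω₀ - ω) = dampedPrior ω₀ κ μ₀ ρ ω := by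
    have habs : |2 * ω₀ - ω - ω₀| = |ω - ω₀| := by rw [abs_sub_comm]; ring_nf
    simp only [dampedPrior, hμ.symm, habs]
  have hpos (ω : ℝ) : 0 ≤ dampedPrior ω₀ κ μ₀ ρ ω := mul_nonneg (Real.exp_pos _).le (hμ.pos ω).le
  refine (mul_le_mul_right
    (lintegral_sub_sq_mul_le_of_symm (measurable_dampedPrior hμ) hpos hsymm a) _).trans ?_
  rw [← lintegral_const_mul' _ _ ENNReal.ofReal_ne_top]
  refine lintegral_mono fun ω => ?_
  rw [← ENNReal.ofReal_mul (by positivity), mul_left_comm]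
  exact ENNReal.ofReal_le_ofReal (mul_le_mul_of_nonneg_left
    (inv_mul_dampedPrior_le_jointDensity hμ hf hκ hs ω) (sq_nonneg _))

lemma lintegral_dampedPrior_le_expectedLoss (hμ : IsTamePrior ω₀ μ₀) (hf : IsSignalDensity f)
    (hκ : ExpComparable ω₀ κ f) (hρ : 0 ≤ ρ) :
    ∫⁻ ω, ENNReal.ofReal ((ω - ω₀) ^ 2 * dampedPrior ω₀ κ μ₀ ρ ω)
      ≤ expectedLoss ω₀ μ₀ f (ENNReal.ofReal ρ) := by
  rcases hρ.eq_or_lt with rfl | hρ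
  · simp [expectedLoss_zero hμ, dampedPrior]
  have hvol : (2 * ρ)⁻¹ * (ω₀ + ρ - (ω₀ - ρ)) = 1 := by field_simp; ring
  rw [expectedLoss_eq_lintegral hμ hf (by simpa using hρ)]
  refine le_trans (le_of_eq ?_) ((setLIntegral_mono' (measurableSet_signalRange _ _) fun s hs =>
    mul_lintegral_dampedPrior_le hμ hf hκ (mem_signalRange_ofReal.1 hs) _).trans
      (setLIntegral_le_lintegral (signalRange ω₀ (ENNReal.ofReal ρ)) _))
  rw [setLIntegral_const, signalRange_ofReal, Real.volume_Ioo, mul_right_comm,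
    ← ENNReal.ofReal_mul (by positivity), hvol, ENNReal.ofReal_one, one_mul]

end ExpectedLoss

section Limits

variable {ι : Type*} {l : Filter ι} {ω₀ κ s : ℝ} {μ₀ : ℝ → ℝ}
  {F : ι → ℝ → ℝ → ℝ} {f : ℝ → ℝ → ℝ} {r : ι → ℝ≥0∞} {r' : ℝ≥0∞}

lemma ExpComparable.of_tendsto [l.NeBot] (hκ : ∀ᶠ i in l, ExpComparable ω₀ κ (F i))
    (hlim : ∀ s ω, Tendsto (fun i => F i s ω) l (𝓝 (f s ω))) : ExpComparable ω₀ κ f :=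
  fun _ _ _ hs ht ω => le_of_tendsto_of_tendsto (hlim _ ω) ((hlim _ ω).mul_const _)
    (hκ.mono fun _ hκi => hκi hs ht ω)

variable [l.IsCountablyGenerated]

lemma tendsto_rangeMass (hF : ∀ i, IsSignalDensity (F i)) (hf : IsSignalDensity f)
    (hlim : ∀ s ω, Tendsto (fun i => F i s ω) l (𝓝 (f s ω))) (hr : Tendsto r l (𝓝 r')) (ω : ℝ) :
    Tendsto (fun i => rangeMass ω₀ (r i) (F i) ω) l (𝓝 (rangeMass ω₀ r' f ω)) := by
  have hL1 : Tendsto (fun i => ∫ s, |F i s ω - f s ω|) l (𝓝 0) :=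
    tendsto_integral_abs_sub_of_nonneg (fun i => (hF i).integrable ω) (hf.integrable ω)
      (fun i s => ((hF i).pos s ω).le) (ae_of_all _ fun s => hlim s ω)
      (by simpa only [(hF _).integral_eq_one, hf.integral_eq_one] using tendsto_const_nhds)
  refine tendsto_setIntegral_of_tendsto_integral_abs_sub (fun i => (hF i).integrable ω)
    (hf.integrable ω) (fun i => measurableSet_signalRange _ _) (measurableSet_signalRange _ _)
    hL1 ?_
  filter_upwards [ae_ofReal_dist_ne ω₀ r'] with s hs using eventually_mem_signalRange_iff hr hs

lemma tendsto_jointDensity (hF : ∀ i, IsSignalDensity (F i)) (hf : IsSignalDensity f)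
    (hlim : ∀ s ω, Tendsto (fun i => F i s ω) l (𝓝 (f s ω))) (hr : Tendsto r l (𝓝 r'))
    (hs : s ∈ signalRange ω₀ r') (ω : ℝ) :
    Tendsto (fun i => jointDensity ω₀ μ₀ (F i) (r i) s ω) l
      (𝓝 (jointDensity ω₀ μ₀ f r' s ω)) := by
  refine Tendsto.mul_const _ ?_
  rw [hf.truncDensity_of_mem hs]
  refine ((hlim s ω).div (tendsto_rangeMass hF hf hlim hr ω)
    (hf.rangeMass_pos (ne_zero_of_mem_signalRange hs) ω).ne').congr' ?_
  filter_upwards [eventually_mem_signalRange hr hs] with i hi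
  exact ((hF i).truncDensity_of_mem hi ω).symm

lemma ExpGrowth.tendsto_integral_mul_jointDensity {φ : ℝ → ℝ} (hφ : ExpGrowth ω₀ φ)
    (hμ : IsTamePrior ω₀ μ₀) (hF : ∀ i, IsSignalDensity (F i)) (hf : IsSignalDensity f)
    (hκ : ∀ᶠ i in l, ExpComparable ω₀ κ (F i))
    (hlim : ∀ s ω, Tendsto (fun i => F i s ω) l (𝓝 (f s ω))) (hr : Tendsto r l (𝓝 r'))
    (hs : s ∈ signalRange ω₀ r') :
    Tendsto (fun i => ∫ ω, φ ω * jointDensity ω₀ μ₀ (F i) (r i) s ω) l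
      (𝓝 (∫ ω, φ ω * jointDensity ω₀ μ₀ f r' s ω)) := by
  obtain ⟨ρ, hsρ, hρr⟩ := exists_radius_of_mem_signalRange hs
  obtain ⟨b, hb, hle⟩ := hφ.exists_integrable_bound hμ κ ((abs_nonneg _).trans_lt hsρ)
  refine tendsto_integral_filter_of_dominated_convergence b (.of_forall fun i =>
    (hφ.measurable.mul (measurable_jointDensity_right hμ (hF i) s)).aestronglyMeasurable) ?_ hb
    (ae_of_all _ fun ω => (tendsto_jointDensity hF hf hlim hr hs ω).const_mul _)
  filter_upwards [hκ, hr.eventually_const_lt hρr] with i hκi hri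
  exact ae_of_all _ (hle (F i) (hF i) hκi (r i) hri.le s hsρ.le)

lemma tendsto_action [l.NeBot] (hμ : IsTamePrior ω₀ μ₀) (hF : ∀ i, IsSignalDensity (F i))
    (hf : IsSignalDensity f) (hκ : ∀ᶠ i in l, ExpComparable ω₀ κ (F i))
    (hlim : ∀ s ω, Tendsto (fun i => F i s ω) l (𝓝 (f s ω))) (hr : Tendsto r l (𝓝 r'))
    (hs : s ∈ signalRange ω₀ r') :
    Tendsto (fun i => action ω₀ μ₀ (F i) s (r i)) l (𝓝 (action ω₀ μ₀ f s r')) := by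
  have hnum := ExpGrowth.id.tendsto_integral_mul_jointDensity hμ hF hf hκ hlim hr hs
  have hden := (ExpGrowth.const 1).tendsto_integral_mul_jointDensity hμ hF hf hκ hlim hr hs
  simp only [one_mul] at hden
  rw [action_eq_div (ne_zero_of_mem_signalRange hs)]
  refine (hnum.div hden
    (integral_jointDensity_pos hμ hf (.of_tendsto hκ hlim) hs).ne').congr' ?_
  filter_upwards [eventually_mem_signalRange hr hs] with i hi
  exact (action_eq_div (ne_zero_of_mem_signalRange hi) s).symm

lemma expectedLoss_le_liminf_of_ne_zero [l.NeBot] (hμ : IsTamePrior ω₀ μ₀)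
    (hF : ∀ i, IsSignalDensity (F i)) (hf : IsSignalDensity f)
    (hκ : ∀ᶠ i in l, ExpComparable ω₀ κ (F i))
    (hlim : ∀ s ω, Tendsto (fun i => F i s ω) l (𝓝 (f s ω))) (hr : Tendsto r l (𝓝 r'))
    (hr' : r' ≠ 0) :
    expectedLoss ω₀ μ₀ f r' ≤ liminf (fun i => expectedLoss ω₀ μ₀ (F i) (r i)) l := by
  have hmeas (i : ι) := measurable_sub_sq_mul_jointDensity (r := r i) hμ (hF i)
    (measurable_action (r := r i) hμ (hF i))
  have hloss : ∀ᶠ i in l, expectedLoss ω₀ μ₀ (F i) (r i) = ∫⁻ s, ∫⁻ ω, ENNReal.ofReal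
      ((ω - action ω₀ μ₀ (F i) s (r i)) ^ 2 * jointDensity ω₀ μ₀ (F i) (r i) s ω) := by
    filter_upwards [hr.eventually_ne hr'] with i hi using expectedLoss_eq_lintegral hμ (hF i) hi
  rw [expectedLoss_eq_lintegral hμ hf hr', liminf_congr hloss]
  refine le_trans (lintegral_mono fun s => ?_)
    (lintegral_liminf_le fun i => (hmeas i).lintegral_prod_right)
  by_cases hs : s ∈ signalRange ω₀ r'
  · refine le_trans (lintegral_mono fun ω => ?_)
      (lintegral_liminf_le fun i => (hmeas i).comp measurable_prodMk_left)
    refine (Tendsto.liminf_eq (ENNReal.tendsto_ofReal (Tendsto.mul ?_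
      (tendsto_jointDensity hF hf hlim hr hs ω)))).ge
    exact ((tendsto_action hμ hF hf hκ hlim hr hs).const_sub ω).pow 2
  · simp [jointDensity_of_notMem hs]

lemma expectedLoss_zero_le_liminf [l.NeBot] (hμ : IsTamePrior ω₀ μ₀)
    (hF : ∀ i, IsSignalDensity (F i)) (hκ : ∀ᶠ i in l, ExpComparable ω₀ κ (F i))
    (hr : Tendsto r l (𝓝 0)) :
    expectedLoss ω₀ μ₀ f 0 ≤ liminf (fun i => expectedLoss ω₀ μ₀ (F i) (r i)) l := by
  have hρ : Tendsto (fun i => (r i).toReal) l (𝓝 0) :=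
    (ENNReal.tendsto_toReal ENNReal.zero_ne_top).comp hr
  have hmeas (i : ι) : Measurable fun ω =>
      ENNReal.ofReal ((ω - ω₀) ^ 2 * dampedPrior ω₀ κ μ₀ (r i).toReal ω) :=
    (Measurable.mul (by fun_prop) (measurable_dampedPrior hμ)).ennreal_ofReal
  calc expectedLoss ω₀ μ₀ f 0
      = ∫⁻ ω, ENNReal.ofReal ((ω - ω₀) ^ 2 * μ₀ ω) := expectedLoss_zero hμ
    _ = ∫⁻ ω, liminf (fun i =>
          ENNReal.ofReal ((ω - ω₀) ^ 2 * dampedPrior ω₀ κ μ₀ (r i).toReal ω)) l :=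
        lintegral_congr fun ω => (Tendsto.liminf_eq (ENNReal.tendsto_ofReal
          (((tendsto_dampedPrior ω).comp hρ).const_mul _))).symm
    _ ≤ liminf (fun i => ∫⁻ ω,
          ENNReal.ofReal ((ω - ω₀) ^ 2 * dampedPrior ω₀ κ μ₀ (r i).toReal ω)) l :=
        lintegral_liminf_le hmeas
    _ ≤ liminf (fun i => expectedLoss ω₀ μ₀ (F i) (r i)) l := by
        refine liminf_le_liminf ?_
        filter_upwards [hκ, hr.eventually_lt_const ENNReal.zero_lt_top] with i hκi hri
        simpa only [ENNReal.ofReal_toReal hri.ne] using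
          lintegral_dampedPrior_le_expectedLoss hμ (hF i) hκi (ENNReal.toReal_nonneg (a := r i))

theorem expectedLoss_le_liminf [l.NeBot] (hμ : IsTamePrior ω₀ μ₀)
    (hF : ∀ i, IsSignalDensity (F i)) (hf : IsSignalDensity f)
    (hκ : ∀ᶠ i in l, ExpComparable ω₀ κ (F i))
    (hlim : ∀ s ω, Tendsto (fun i => F i s ω) l (𝓝 (f s ω))) (hr : Tendsto r l (𝓝 r')) :
    expectedLoss ω₀ μ₀ f r' ≤ liminf (fun i => expectedLoss ω₀ μ₀ (F i) (r i)) l := by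
  rcases eq_or_ne r' 0 with rfl | hr'
  · exact expectedLoss_zero_le_liminf hμ hF hκ hr
  · exact expectedLoss_le_liminf_of_ne_zero hμ hF hf hκ hlim hr hr'

end Limits

section Mixtures

variable {ω₀ κ κ' h q q' : ℝ} {f g : ℝ → ℝ → ℝ}

lemma IsSignalDensity.mix (hf : IsSignalDensity f) (hg : IsSignalDensity g)
    (hh : h ∈ Set.Icc (0 : ℝ) 1) : IsSignalDensity fun s ω => h * f s ω + (1 - h) * g s ω where
  measurable := (hf.measurable.const_mul h).add (hg.measurable.const_mul (1 - h))
  pos s ω := by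
    rcases hh.1.eq_or_lt with rfl | h0
    · simpa using hg.pos s ω
    · exact add_pos_of_pos_of_nonneg (mul_pos h0 (hf.pos s ω))
        (mul_nonneg (sub_nonneg.2 hh.2) (hg.pos s ω).le)
  integral_eq_one ω := by
    rw [integral_add ((hf.integrable ω).const_mul _) ((hg.integrable ω).const_mul _),
      integral_const_mul, integral_const_mul, hf.integral_eq_one, hg.integral_eq_one]
    ring

lemma ExpComparable.mix (hf : ExpComparable ω₀ κ f) (hg : ExpComparable ω₀ κ g)
    (hh : h ∈ Set.Icc (0 : ℝ) 1) :
    ExpComparable ω₀ κ fun s ω => h * f s ω + (1 - h) * g s ω := by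
  intro ρ s t hs ht ω
  simp only [add_mul, mul_assoc h, mul_assoc (1 - h)]
  exact add_le_add (mul_le_mul_of_nonneg_left (hf hs ht ω) hh.1)
    (mul_le_mul_of_nonneg_left (hg hs ht ω) (sub_nonneg.2 hh.2))

/-- Signals whose error `s - ω` has mean zero and variance `q` in every state `ω`. -/
structure HasErrorVariance (f : ℝ → ℝ → ℝ) (q : ℝ) : Prop where
  integrable_sub : ∀ ω, Integrable fun s => (s - ω) * f s ω
  integrable_sub_sq : ∀ ω, Integrable fun s => (s - ω) ^ 2 * f s ω
  mean_eq_zero : ∀ ω, ∫ s, (s - ω) * f s ω = 0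
  variance_eq : ∀ ω, ∫ s, (s - ω) ^ 2 * f s ω = q

lemma HasErrorVariance.mix (hf : HasErrorVariance f q) (hg : HasErrorVariance g q') (h : ℝ) :
    HasErrorVariance (fun s ω => h * f s ω + (1 - h) * g s ω) (h * q + (1 - h) * q') := by
  have hfac (u a b : ℝ) : u * (h * a + (1 - h) * b) = h * (u * a) + (1 - h) * (u * b) := by ring
  constructor <;> intro ω <;> simp only [hfac]
  · exact ((hf.integrable_sub ω).const_mul _).add ((hg.integrable_sub ω).const_mul _)
  · exact ((hf.integrable_sub_sq ω).const_mul _).add ((hg.integrable_sub_sq ω).const_mul _)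
  · rw [integral_add ((hf.integrable_sub ω).const_mul _) ((hg.integrable_sub ω).const_mul _),
      integral_const_mul, integral_const_mul, hf.mean_eq_zero, hg.mean_eq_zero]
    ring
  · rw [integral_add ((hf.integrable_sub_sq ω).const_mul _)
      ((hg.integrable_sub_sq ω).const_mul _), integral_const_mul, integral_const_mul,
      hf.variance_eq, hg.variance_eq]

lemma HasErrorVariance.nonneg (hq : HasErrorVariance f q) (hf : IsSignalDensity f) : 0 ≤ q := by
  rw [← hq.variance_eq 0]
  exact integral_nonneg fun s => mul_nonneg (sq_nonneg _) (hf.pos s 0).le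

lemma HasErrorVariance.integral_linear_error_sq_mul (hq : HasErrorVariance f q)
    (hf : IsSignalDensity f) (a b ω : ℝ) :
    Integrable (fun s => (a - b * (s - ω)) ^ 2 * f s ω) ∧
      ∫ s, (a - b * (s - ω)) ^ 2 * f s ω = a ^ 2 + b ^ 2 * q := by
  have hexpand (s : ℝ) : (a - b * (s - ω)) ^ 2 * f s ω
      = b ^ 2 * ((s - ω) ^ 2 * f s ω) + (a ^ 2 * f s ω - 2 * a * b * ((s - ω) * f s ω)) := by ring
  have h2 := (hq.integrable_sub_sq ω).const_mul (b ^ 2)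
  have h1 := (hq.integrable_sub ω).const_mul (2 * a * b)
  have h0 := (hf.integrable ω).const_mul (a ^ 2)
  have h01 : Integrable fun s => a ^ 2 * f s ω - 2 * a * b * ((s - ω) * f s ω) := h0.sub h1
  simp only [hexpand]
  refine ⟨h2.add h01, ?_⟩
  rw [integral_add h2 h01, integral_sub h0 h1, integral_const_mul, integral_const_mul,
    integral_const_mul, hq.variance_eq, hq.mean_eq_zero, hf.integral_eq_one]
  ring

-- The bound is the loss of the linear decision rule `s ↦ ω₀ + c * (s - ω₀)`.
lemma HasErrorVariance.expectedLoss_top_le {μ₀ : ℝ → ℝ} (hq : HasErrorVariance f q)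
    (hμ : IsTamePrior ω₀ μ₀) (hf : IsSignalDensity f) (hκ : ExpComparable ω₀ κ f) (c : ℝ) :
    expectedLoss ω₀ μ₀ f ⊤
      ≤ ENNReal.ofReal ((1 - c) ^ 2 * (∫ ω, (ω - ω₀) ^ 2 * μ₀ ω) + c ^ 2 * q) := by
  have hvar := (hμ.integrable_mul (.sub_sq ω₀)).const_mul ((1 - c) ^ 2)
  have hnoise := hμ.integrable_mul (.const (c ^ 2 * q))
  have hsum : Integrable fun ω =>
      (1 - c) ^ 2 * ((ω - ω₀) ^ 2 * μ₀ ω) + c ^ 2 * q * μ₀ ω := hvar.add hnoise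
  have hinner (ω : ℝ) : ∫⁻ s, ENNReal.ofReal ((ω - (ω₀ + c * (s - ω₀))) ^ 2 * (f s ω * μ₀ ω))
      = ENNReal.ofReal ((1 - c) ^ 2 * ((ω - ω₀) ^ 2 * μ₀ ω) + c ^ 2 * q * μ₀ ω) := by
    obtain ⟨hint, heq⟩ := hq.integral_linear_error_sq_mul hf ((1 - c) * (ω - ω₀)) c ω
    have herror (s : ℝ) : (ω - (ω₀ + c * (s - ω₀))) ^ 2 * (f s ω * μ₀ ω)
        = ((1 - c) * (ω - ω₀) - c * (s - ω)) ^ 2 * f s ω * μ₀ ω := by ring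
    simp only [herror]
    rw [← ofReal_integral_eq_lintegral_ofReal (hint.mul_const _) (ae_of_all _ fun s =>
      mul_nonneg (mul_nonneg (sq_nonneg _) (hf.pos s ω).le) (hμ.pos ω).le),
      integral_mul_const, heq]
    ring_nf
  calc expectedLoss ω₀ μ₀ f ⊤
      ≤ ∫⁻ s, ∫⁻ ω, ENNReal.ofReal ((ω - (ω₀ + c * (s - ω₀))) ^ 2 * (f s ω * μ₀ ω)) := by
        simpa [jointDensity, truncDensity] using
          expectedLoss_le hμ hf hκ ENNReal.top_ne_zero fun s => ω₀ + c * (s - ω₀)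
    _ = ∫⁻ ω, ∫⁻ s, ENNReal.ofReal ((ω - (ω₀ + c * (s - ω₀))) ^ 2 * (f s ω * μ₀ ω)) := by
        refine lintegral_lintegral_swap (Measurable.aemeasurable ?_)
        have := hf.measurable
        have := hμ.measurable
        fun_prop
    _ = ENNReal.ofReal ((1 - c) ^ 2 * (∫ ω, (ω - ω₀) ^ 2 * μ₀ ω) + c ^ 2 * q) := by
        simp only [hinner]
        rw [← ofReal_integral_eq_lintegral_ofReal hsum (ae_of_all _ fun ω =>
          add_nonneg (mul_nonneg (sq_nonneg _) (mul_nonneg (sq_nonneg _) (hμ.pos ω).le))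
            (mul_nonneg (mul_nonneg (sq_nonneg _) (hq.nonneg hf)) (hμ.pos ω).le)),
          integral_add hvar hnoise, integral_const_mul, integral_const_mul,
          hμ.integral_eq_one, mul_one]

end Mixtures

section Gaussian

variable {v : ℝ≥0}

lemma continuous_gaussianPDFReal (m : ℝ) (v : ℝ≥0) : Continuous (gaussianPDFReal m v) := by
  rw [gaussianPDFReal_def]
  fun_prop

lemma hasDerivAt_gaussianPDFReal (hv : v ≠ 0) (m x : ℝ) :
    HasDerivAt (gaussianPDFReal m v) (-(x - m) / v * gaussianPDFReal m v x) x := by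
  have hv' : (v : ℝ) ≠ 0 := by exact_mod_cast hv
  have hexponent : HasDerivAt (fun y => -(y - m) ^ 2 / (2 * (v : ℝ))) (-(x - m) / v) x := by
    refine ((((hasDerivAt_id x).sub_const m).pow 2).neg.div_const (2 * (v : ℝ))).congr_deriv ?_
    simp only [id]
    field_simp
    push_cast
    ring
  refine (hexponent.exp.const_mul (√(2 * Real.pi * v))⁻¹).congr_deriv ?_
  simp only [gaussianPDFReal]
  ring

lemma tendsto_gaussianPDFReal {ι : Type*} {l : Filter ι} {w : ι → ℝ≥0} (hv : v ≠ 0)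
    (hw : Tendsto w l (𝓝 v)) (m x : ℝ) :
    Tendsto (fun i => gaussianPDFReal m (w i) x) l (𝓝 (gaussianPDFReal m v x)) := by
  have hcoe : Tendsto (fun i => (w i : ℝ)) l (𝓝 (v : ℝ)) := NNReal.tendsto_coe.2 hw
  have : (0 : ℝ) < v := by exact_mod_cast pos_iff_ne_zero.2 hv
  simp only [gaussianPDFReal]
  exact ((hcoe.const_mul _).sqrt.inv₀ (by positivity)).mul
    ((Real.continuous_exp.tendsto _).comp
      (tendsto_const_nhds.div (hcoe.const_mul 2) (by positivity)))

lemma integrable_exp_mul_abs_mul_gaussianPDFReal (hv : v ≠ 0) (m c : ℝ) :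
    Integrable fun x => Real.exp (c * |x - m|) * gaussianPDFReal m v x := by
  have hexp (t : ℝ) : Integrable (fun x => Real.exp (t * (x - m))) (gaussianReal m v) := by
    simpa only [← Real.exp_add, ← sub_eq_add_neg, ← mul_sub] using
      (integrable_exp_mul_gaussianReal (μ := m) (v := v) t).mul_const (Real.exp (-(t * m)))
  have habs : Integrable (fun x => Real.exp (c * |x - m|)) (gaussianReal m v) :=
    integrable_exp_mul_abs (hexp c) (hexp (-c))
  rw [gaussianReal_of_var_ne_zero _ hv, integrable_withDensity_iff_integrable_smul'
    (measurable_gaussianPDF m v) (ae_of_all _ fun _ => gaussianPDF_lt_top)] at habs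
  simpa only [toReal_gaussianPDF, smul_eq_mul, mul_comm] using habs

lemma isTamePrior_gaussianPDFReal (hv : v ≠ 0) (m : ℝ) : IsTamePrior m (gaussianPDFReal m v) where
  measurable := measurable_gaussianPDFReal m v
  pos x := gaussianPDFReal_pos m v x hv
  integral_eq_one := integral_gaussianPDFReal_eq_one m hv
  symm x := by
    simp only [gaussianPDFReal]
    ring_nf
  integrable_exp := integrable_exp_mul_abs_mul_gaussianPDFReal hv m

lemma integral_sub_sq_mul_gaussianPDFReal (hv : v ≠ 0) (m : ℝ) :
    ∫ x, (x - m) ^ 2 * gaussianPDFReal m v x = v := by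
  have hvar := variance_fun_id_gaussianReal (μ := m) (v := v)
  rw [variance_eq_integral (by fun_prop), integral_id_gaussianReal,
    integral_gaussianReal_eq_integral_smul hv] at hvar
  simpa only [smul_eq_mul, mul_comm] using hvar

/-- The density of a normal signal of variance `v` around the state. -/
def normalSignal (v : ℝ≥0) (s ω : ℝ) : ℝ := gaussianPDFReal ω v s

lemma isSignalDensity_normalSignal (hv : v ≠ 0) : IsSignalDensity (normalSignal v) where
  measurable := by
    simp only [normalSignal, gaussianPDFReal]
    fun_prop
  pos s ω := gaussianPDFReal_pos ω v s hv
  integral_eq_one ω := integral_gaussianPDFReal_eq_one ω hv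

lemma hasErrorVariance_normalSignal (hv : v ≠ 0) : HasErrorVariance (normalSignal v) v where
  integrable_sub ω := (isTamePrior_gaussianPDFReal hv ω).integrable_mul (.sub_const ω)
  integrable_sub_sq ω := (isTamePrior_gaussianPDFReal hv ω).integrable_mul (.sub_sq ω)
  mean_eq_zero ω := (isTamePrior_gaussianPDFReal hv ω).integral_sub_mul
  variance_eq := integral_sub_sq_mul_gaussianPDFReal hv

lemma sq_sub_sq_le_of_abs_sub_le {ω₀ ρ s t : ℝ} (hs : |s - ω₀| ≤ ρ) (ht : |t - ω₀| ≤ ρ) (ω : ℝ) :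
    (s - ω) ^ 2 - (t - ω) ^ 2 ≤ 4 * ρ * (ρ + |ω - ω₀|) := by
  obtain ⟨hs1, hs2⟩ := abs_le.1 hs
  obtain ⟨ht1, ht2⟩ := abs_le.1 ht
  have hdiff : |s - t| ≤ 2 * ρ := abs_le.2 ⟨by linarith, by linarith⟩
  have hsum : |s + t - 2 * ω| ≤ 2 * (ρ + |ω - ω₀|) := by
    have := neg_abs_le (ω - ω₀)
    have := le_abs_self (ω - ω₀)
    exact abs_le.2 ⟨by linarith, by linarith⟩
  calc (s - ω) ^ 2 - (t - ω) ^ 2 = (s - t) * (s + t - 2 * ω) := by ring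
    _ ≤ |s - t| * |s + t - 2 * ω| := (le_abs_self _).trans_eq (abs_mul _ _)
    _ ≤ 2 * ρ * (2 * (ρ + |ω - ω₀|)) :=
        mul_le_mul hdiff hsum (abs_nonneg _) ((abs_nonneg _).trans hdiff)
    _ = 4 * ρ * (ρ + |ω - ω₀|) := by ring

lemma expComparable_normalSignal {u : ℝ} (hu : 0 < u) (huv : u ≤ v) (ω₀ : ℝ) :
    ExpComparable ω₀ (2 / u) (normalSignal v) := by
  intro ρ s t hs ht ω
  have hv : (0 : ℝ) < v := hu.trans_le huv
  have hρ : 0 ≤ ρ := (abs_nonneg _).trans hs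
  have hexponent : -(t - ω) ^ 2 / (2 * v)
      ≤ -(s - ω) ^ 2 / (2 * v) + 2 / u * ρ * (ρ + |ω - ω₀|) := by
    calc -(t - ω) ^ 2 / (2 * v)
        = -(s - ω) ^ 2 / (2 * v) + ((s - ω) ^ 2 - (t - ω) ^ 2) / (2 * v) := by ring
      _ ≤ -(s - ω) ^ 2 / (2 * v) + 4 * ρ * (ρ + |ω - ω₀|) / (2 * u) := by
          gcongr
          exact sq_sub_sq_le_of_abs_sub_le hs ht ω
      _ = -(s - ω) ^ 2 / (2 * v) + 2 / u * ρ * (ρ + |ω - ω₀|) := by ring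
  simp only [normalSignal, gaussianPDFReal]
  rw [mul_assoc _ (Real.exp _), ← Real.exp_add]
  gcongr

lemma exists_gaussianPDFReal_mul_eq {w : ℝ≥0} (hv : v ≠ 0) (hw : w ≠ 0) (m s : ℝ) :
    ∃ K : ℝ, 0 < K ∧ ∀ ω, gaussianPDFReal ω v s * gaussianPDFReal m w ω =
      K * gaussianPDFReal ((v * m + w * s) / (w + v)) (w * v / (w + v)) ω := by
  have : (0 : ℝ) < v := by exact_mod_cast pos_iff_ne_zero.2 hv
  have : (0 : ℝ) < w := by exact_mod_cast pos_iff_ne_zero.2 hw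
  have hexp (ω : ℝ) : Real.exp (-(s - ω) ^ 2 / (2 * v)) * Real.exp (-(ω - m) ^ 2 / (2 * w)) =
      Real.exp (-(s - m) ^ 2 / (2 * (w + v))) *
        Real.exp (-(ω - (v * m + w * s) / (w + v)) ^ 2 / (2 * (w * v / (w + v)))) := by
    rw [← Real.exp_add, ← Real.exp_add]
    congr 1
    field_simp
    ring
  refine ⟨(√(2 * Real.pi * v))⁻¹ * (√(2 * Real.pi * w))⁻¹ *
    √(2 * Real.pi * (w * v / (w + v))) * Real.exp (-(s - m) ^ 2 / (2 * (w + v))),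
    by positivity, fun ω => ?_⟩
  have : √(2 * Real.pi * (w * v / (w + v) : ℝ)) ≠ 0 := by positivity
  simp only [gaussianPDFReal]
  push_cast
  rw [mul_mul_mul_comm, hexp]
  field_simp

lemma action_top_normalSignal {v₀ : ℝ≥0} (hv₀ : v₀ ≠ 0) (hv : v ≠ 0) (ω₀ s : ℝ) :
    action ω₀ (gaussianPDFReal ω₀ v₀) (normalSignal v) s ⊤
      = v * ω₀ / (v₀ + v) + v₀ / (v₀ + v) * s := by
  obtain ⟨K, hK, hprod⟩ := exists_gaussianPDFReal_mul_eq hv hv₀ ω₀ s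
  have hw : v₀ * v / (v₀ + v) ≠ 0 := by positivity
  have hposterior := isTamePrior_gaussianPDFReal hw ((v * ω₀ + v₀ * s) / (v₀ + v))
  have hjoint (ω : ℝ) : jointDensity ω₀ (gaussianPDFReal ω₀ v₀) (normalSignal v) ⊤ s ω
      = K * gaussianPDFReal ((v * ω₀ + v₀ * s) / (v₀ + v)) (v₀ * v / (v₀ + v)) ω := by
    rw [jointDensity, truncDensity, if_pos rfl, normalSignal, hprod]
  simp only [action_eq_div ENNReal.top_ne_zero, hjoint, mul_left_comm _ K]
  rw [integral_const_mul, integral_const_mul, hposterior.integral_mul_self,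
    hposterior.integral_eq_one]
  field_simp

end Gaussian

section TruncatedNormal

variable {v : ℝ≥0} {p q : ℝ}

lemma mem_Ioo_of_intervalIntegral_sub_mul_eq_zero {w : ℝ → ℝ} {c : ℝ} (hw : Continuous w)
    (hpos : ∀ x, 0 < w x) (hpq : p < q) (hc : ∫ x in p..q, (x - c) * w x = 0) :
    c ∈ Set.Ioo p q := by
  constructor <;> by_contra! hcon
  · refine (intervalIntegral.intervalIntegral_pos_of_pos_on
      (Continuous.intervalIntegrable (by fun_prop) p q)
      (fun x hx => mul_pos (sub_pos.2 (hcon.trans_lt hx.1)) (hpos x)) hpq).ne' hc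
  · refine (intervalIntegral.intervalIntegral_pos_of_pos_on
      (Continuous.intervalIntegrable (by fun_prop) p q)
      (fun x hx => mul_pos (sub_pos.2 (hx.2.trans_le hcon)) (hpos x)) hpq).ne' ?_
    rw [← neg_eq_zero, ← intervalIntegral.integral_neg, ← hc]
    congr 1 with x
    ring

lemma intervalIntegral_gaussianPDFReal_pos (hv : v ≠ 0) (m : ℝ) (hpq : p < q) :
    0 < ∫ x in p..q, gaussianPDFReal m v x :=
  intervalIntegral.intervalIntegral_pos_of_pos_on
    ((continuous_gaussianPDFReal m v).intervalIntegrable _ _)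
    (fun x _ => gaussianPDFReal_pos m v x hv) hpq

/-- The mean of a normal variable of mean `m` and variance `v` conditioned to lie in `[p, q]`, in
the closed form obtained from `φ' (x) = -(x - m) / v * φ x`. -/
def truncMean (v : ℝ≥0) (m p q : ℝ) : ℝ :=
  m + v * (gaussianPDFReal m v p - gaussianPDFReal m v q) / ∫ x in p..q, gaussianPDFReal m v x

lemma intervalIntegral_sub_truncMean_mul (hv : v ≠ 0) (m : ℝ) (hpq : p < q) :
    ∫ x in p..q, (x - truncMean v m p q) * gaussianPDFReal m v x = 0 := by
  have hv' : (v : ℝ) ≠ 0 := by exact_mod_cast hv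
  have hcont := continuous_gaussianPDFReal m v
  have hZ := intervalIntegral_gaussianPDFReal_pos hv m hpq
  have hfirst : ∫ x in p..q, (x - m) * gaussianPDFReal m v x
      = -(v : ℝ) * gaussianPDFReal m v q - -(v : ℝ) * gaussianPDFReal m v p := by
    refine intervalIntegral.integral_eq_sub_of_hasDerivAt
      (f := fun x => -(v : ℝ) * gaussianPDFReal m v x) (fun x _ => ?_)
      (Continuous.intervalIntegrable (by fun_prop) _ _)
    refine ((hasDerivAt_gaussianPDFReal hv m x).const_mul (-(v : ℝ))).congr_deriv ?_
    field_simp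
  have hsplit : ∫ x in p..q, (x - truncMean v m p q) * gaussianPDFReal m v x
      = (∫ x in p..q, (x - m) * gaussianPDFReal m v x)
        - (truncMean v m p q - m) * ∫ x in p..q, gaussianPDFReal m v x := by
    rw [← intervalIntegral.integral_const_mul, ← intervalIntegral.integral_sub
      (Continuous.intervalIntegrable (by fun_prop) _ _)
      (Continuous.intervalIntegrable (by fun_prop) _ _)]
    congr 1 with x
    ring
  rw [hsplit, hfirst, truncMean]
  field_simp
  ring

lemma truncMean_mem_Ioo (hv : v ≠ 0) (m : ℝ) (hpq : p < q) :
    truncMean v m p q ∈ Set.Ioo p q :=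
  mem_Ioo_of_intervalIntegral_sub_mul_eq_zero (continuous_gaussianPDFReal m v)
    (fun x => gaussianPDFReal_pos m v x hv) hpq (intervalIntegral_sub_truncMean_mul hv m hpq)

lemma intervalIntegral_sub_truncMean_sq_mul (hv : v ≠ 0) (m : ℝ) (hpq : p < q) :
    ∫ x in p..q, (x - truncMean v m p q) ^ 2 * gaussianPDFReal m v x
      = v * (∫ x in p..q, gaussianPDFReal m v x)
        - v * ((q - truncMean v m p q) * gaussianPDFReal m v q
          + (truncMean v m p q - p) * gaussianPDFReal m v p) := by
  have hv' : (v : ℝ) ≠ 0 := by exact_mod_cast hv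
  have hcont := continuous_gaussianPDFReal m v
  have hmean := intervalIntegral_sub_truncMean_mul hv m hpq
  set c := truncMean v m p q
  have hparts : ∫ x in p..q, ((x - m) * (x - c) * gaussianPDFReal m v x
        - v * gaussianPDFReal m v x)
      = -(v : ℝ) * ((q - c) * gaussianPDFReal m v q)
        - -(v : ℝ) * ((p - c) * gaussianPDFReal m v p) := by
    refine intervalIntegral.integral_eq_sub_of_hasDerivAt
      (f := fun x => -(v : ℝ) * ((x - c) * gaussianPDFReal m v x)) (fun x _ => ?_)
      (Continuous.intervalIntegrable (by fun_prop) _ _)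
    refine ((((hasDerivAt_id x).sub_const c).mul
      (hasDerivAt_gaussianPDFReal hv m x)).const_mul (-(v : ℝ))).congr_deriv ?_
    simp only [id]
    field_simp
    ring
  have hsplit : ∫ x in p..q, (x - c) ^ 2 * gaussianPDFReal m v x
      = (∫ x in p..q, ((x - m) * (x - c) * gaussianPDFReal m v x - v * gaussianPDFReal m v x))
        + (v * (∫ x in p..q, gaussianPDFReal m v x)
          - (c - m) * ∫ x in p..q, (x - c) * gaussianPDFReal m v x) := by
    rw [← intervalIntegral.integral_const_mul, ← intervalIntegral.integral_const_mul,
      ← intervalIntegral.integral_sub, ← intervalIntegral.integral_add]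
    · congr 1 with x
      ring
    all_goals exact Continuous.intervalIntegrable (by fun_prop) _ _
  rw [hsplit, hparts, hmean]
  ring

lemma intervalIntegral_sub_truncMean_sq_mul_lt (hv : v ≠ 0) (m : ℝ) (hpq : p < q) :
    ∫ x in p..q, (x - truncMean v m p q) ^ 2 * gaussianPDFReal m v x
      < v * ∫ x in p..q, gaussianPDFReal m v x := by
  obtain ⟨hpc, hcq⟩ := truncMean_mem_Ioo hv m hpq
  have hv' : (0 : ℝ) < v := by exact_mod_cast pos_iff_ne_zero.2 hv
  rw [intervalIntegral_sub_truncMean_sq_mul hv m hpq]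
  exact sub_lt_self _ (mul_pos hv' (add_pos
    (mul_pos (sub_pos.2 hcq) (gaussianPDFReal_pos m v q hv))
    (mul_pos (sub_pos.2 hpc) (gaussianPDFReal_pos m v p hv))))

lemma intervalIntegral_affine_sq_mul_lt (hv : v ≠ 0) (m : ℝ) (hpq : p < q) (d : ℝ) :
    ∫ x in p..q, ((x - truncMean v m p q) / v - d) ^ 2 * gaussianPDFReal m v x
      < (d ^ 2 + 1 / v) * ∫ x in p..q, gaussianPDFReal m v x := by
  have : (0 : ℝ) < v := by exact_mod_cast pos_iff_ne_zero.2 hv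
  have hcont := continuous_gaussianPDFReal m v
  have hmean := intervalIntegral_sub_truncMean_mul hv m hpq
  have hvar := intervalIntegral_sub_truncMean_sq_mul_lt hv m hpq
  set c := truncMean v m p q
  calc ∫ x in p..q, ((x - c) / v - d) ^ 2 * gaussianPDFReal m v x
      = d ^ 2 * (∫ x in p..q, gaussianPDFReal m v x)
        - 2 * d / v * (∫ x in p..q, (x - c) * gaussianPDFReal m v x)
        + 1 / v ^ 2 * ∫ x in p..q, (x - c) ^ 2 * gaussianPDFReal m v x := by
        rw [← intervalIntegral.integral_const_mul, ← intervalIntegral.integral_const_mul,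
          ← intervalIntegral.integral_const_mul, ← intervalIntegral.integral_sub,
          ← intervalIntegral.integral_add]
        · congr 1 with x
          field_simp
          ring
        all_goals exact Continuous.intervalIntegrable (by fun_prop) _ _
    _ < d ^ 2 * (∫ x in p..q, gaussianPDFReal m v x) - 2 * d / v * 0
        + 1 / v ^ 2 * (v * ∫ x in p..q, gaussianPDFReal m v x) := by
        rw [hmean]
        gcongr
    _ = (d ^ 2 + 1 / v) * ∫ x in p..q, gaussianPDFReal m v x := by
        field_simp
        ring

lemma hasDerivAt_intervalIntegral_gaussianPDFReal (v : ℝ≥0) (p q m : ℝ) :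
    HasDerivAt (fun m => ∫ x in p..q, gaussianPDFReal m v x)
      (gaussianPDFReal m v p - gaussianPDFReal m v q) m := by
  have hcont := continuous_gaussianPDFReal 0 v
  have hshift (b m : ℝ) : gaussianPDFReal m v b = gaussianPDFReal 0 v (b - m) := by
    rw [gaussianPDFReal_sub, zero_add]
  have hprimitive (b : ℝ) : HasDerivAt (fun m => ∫ x in (0 : ℝ)..(b - m), gaussianPDFReal 0 v x)
      (-gaussianPDFReal m v b) m := by
    refine ((hcont.integral_hasStrictDerivAt 0 (b - m)).hasDerivAt.comp m
      ((hasDerivAt_id m).const_sub b)).congr_deriv ?_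
    rw [mul_neg_one, hshift b m]
  have hsplit (m : ℝ) : ∫ x in p..q, gaussianPDFReal m v x
      = (∫ x in (0 : ℝ)..(q - m), gaussianPDFReal 0 v x)
        - ∫ x in (0 : ℝ)..(p - m), gaussianPDFReal 0 v x := by
    simp only [hshift _ m]
    rw [intervalIntegral.integral_comp_sub_right (gaussianPDFReal 0 v),
      intervalIntegral.integral_interval_sub_left (hcont.intervalIntegrable _ _)
        (hcont.intervalIntegrable _ _)]
  simp only [hsplit]
  refine ((hprimitive q).sub (hprimitive p)).congr_deriv ?_
  ring

lemma continuous_truncMean (hv : v ≠ 0) (hpq : p < q) :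
    Continuous fun m => truncMean v m p q := by
  have hmass : Continuous fun m => ∫ x in p..q, gaussianPDFReal m v x :=
    continuous_iff_continuousAt.2 fun m =>
      (hasDerivAt_intervalIntegral_gaussianPDFReal v p q m).continuousAt
  have hend (b : ℝ) : Continuous fun m => gaussianPDFReal m v b := by
    simp only [gaussianPDFReal]
    fun_prop
  exact continuous_id.add (((((hend p).sub (hend q)).const_mul _)).div hmass
    fun m => (intervalIntegral_gaussianPDFReal_pos hv m hpq).ne')

end TruncatedNormal

section CramerRao

variable {v₀ v : ℝ≥0} {ω₀ ρ s : ℝ}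

lemma setIntegral_signalRange_ofReal (hρ : 0 ≤ ρ) (ω₀ : ℝ) (g : ℝ → ℝ) :
    ∫ s in signalRange ω₀ (ENNReal.ofReal ρ), g s = ∫ s in (ω₀ - ρ)..(ω₀ + ρ), g s := by
  rw [signalRange_ofReal, ← integral_Ioc_eq_integral_Ioo,
    intervalIntegral.integral_of_le (by linarith)]

/-- The derivative in the state `ω` of the logarithm of the joint density of the state and a
normal signal truncated at radius `ρ`. -/
def jointScore (ω₀ : ℝ) (v₀ v : ℝ≥0) (ρ s ω : ℝ) : ℝ :=
  (s - truncMean v ω (ω₀ - ρ) (ω₀ + ρ)) / v - (ω - ω₀) / v₀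

lemma continuous_jointScore (hv : v ≠ 0) (hρ : 0 < ρ) (ω₀ : ℝ) (v₀ : ℝ≥0) :
    Continuous fun x : ℝ × ℝ => jointScore ω₀ v₀ v ρ x.1 x.2 := by
  have hmean := continuous_truncMean hv (show ω₀ - ρ < ω₀ + ρ by linarith)
  unfold jointScore
  fun_prop

lemma truncDensity_normalSignal (hv : v ≠ 0) (hs : s ∈ signalRange ω₀ (ENNReal.ofReal ρ))
    (hρ : 0 < ρ) (ω : ℝ) :
    truncDensity ω₀ (ENNReal.ofReal ρ) (normalSignal v) s ω
      = gaussianPDFReal ω v s / ∫ x in (ω₀ - ρ)..(ω₀ + ρ), gaussianPDFReal ω v x := by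
  rw [(isSignalDensity_normalSignal hv).truncDensity_of_mem hs, rangeMass,
    setIntegral_signalRange_ofReal hρ.le]
  rfl

lemma hasDerivAt_jointDensity (hv₀ : v₀ ≠ 0) (hv : v ≠ 0) (hρ : 0 < ρ)
    (hs : s ∈ signalRange ω₀ (ENNReal.ofReal ρ)) (ω : ℝ) :
    HasDerivAt (jointDensity ω₀ (gaussianPDFReal ω₀ v₀) (normalSignal v) (ENNReal.ofReal ρ) s)
      (jointScore ω₀ v₀ v ρ s ω *
        jointDensity ω₀ (gaussianPDFReal ω₀ v₀) (normalSignal v) (ENNReal.ofReal ρ) s ω) ω := by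
  have hv' : (v : ℝ) ≠ 0 := by exact_mod_cast hv
  have hv₀' : (v₀ : ℝ) ≠ 0 := by exact_mod_cast hv₀
  have hZ := (intervalIntegral_gaussianPDFReal_pos hv ω (show ω₀ - ρ < ω₀ + ρ by linarith)).ne'
  have hjoint : jointDensity ω₀ (gaussianPDFReal ω₀ v₀) (normalSignal v) (ENNReal.ofReal ρ) s
      = fun ω => gaussianPDFReal s v ω / (∫ x in (ω₀ - ρ)..(ω₀ + ρ), gaussianPDFReal ω v x)
        * gaussianPDFReal ω₀ v₀ ω := by
    ext ω
    have hcomm : gaussianPDFReal ω v s = gaussianPDFReal s v ω := by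
      rw [gaussianPDFReal, gaussianPDFReal, ← neg_sub s ω, neg_sq]
    rw [jointDensity, truncDensity_normalSignal hv hs hρ, hcomm]
  rw [hjoint]
  refine (((hasDerivAt_gaussianPDFReal hv s ω).div
    (hasDerivAt_intervalIntegral_gaussianPDFReal v _ _ ω) hZ).mul
    (hasDerivAt_gaussianPDFReal hv₀ ω₀ ω)).congr_deriv ?_
  simp only [Pi.div_apply, jointScore, truncMean]
  field_simp
  ring

lemma integrableOn_jointScore_sq_mul_truncDensity (hv : v ≠ 0) (hρ : 0 < ρ) (ω₀ : ℝ) (v₀ : ℝ≥0)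
    (ω : ℝ) :
    IntegrableOn (fun s => jointScore ω₀ v₀ v ρ s ω ^ 2 *
      truncDensity ω₀ (ENNReal.ofReal ρ) (normalSignal v) s ω)
      (signalRange ω₀ (ENNReal.ofReal ρ)) := by
  have hcont : Continuous fun s => jointScore ω₀ v₀ v ρ s ω ^ 2 *
      (gaussianPDFReal ω v s / ∫ x in (ω₀ - ρ)..(ω₀ + ρ), gaussianPDFReal ω v x) :=
    (((continuous_jointScore hv hρ ω₀ v₀).comp (Continuous.prodMk_left ω)).pow 2).mul
      ((continuous_gaussianPDFReal ω v).div_const _)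
  have hsub : signalRange ω₀ (ENNReal.ofReal ρ) ⊆ Set.Icc (ω₀ - ρ) (ω₀ + ρ) := by
    rw [signalRange_ofReal]
    exact Set.Ioo_subset_Icc_self
  refine ((hcont.continuousOn.integrableOn_Icc).mono_set hsub).congr_fun (fun s hs => ?_)
    (measurableSet_signalRange _ _)
  simp only [truncDensity_normalSignal hv hs hρ]

-- Truncation lowers the variance, hence the information that the signal carries on the state.
lemma setIntegral_jointScore_sq_mul_truncDensity_lt (hv : v ≠ 0) (hρ : 0 < ρ) (ω₀ : ℝ) (v₀ : ℝ≥0)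
    (ω : ℝ) :
    ∫ s in signalRange ω₀ (ENNReal.ofReal ρ), jointScore ω₀ v₀ v ρ s ω ^ 2 *
      truncDensity ω₀ (ENNReal.ofReal ρ) (normalSignal v) s ω
      < ((ω - ω₀) / v₀) ^ 2 + 1 / v := by
  have hpq : ω₀ - ρ < ω₀ + ρ := by linarith
  have hcongr : ∀ s ∈ signalRange ω₀ (ENNReal.ofReal ρ), jointScore ω₀ v₀ v ρ s ω ^ 2 *
      truncDensity ω₀ (ENNReal.ofReal ρ) (normalSignal v) s ω
      = jointScore ω₀ v₀ v ρ s ω ^ 2 * gaussianPDFReal ω v s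
        / ∫ x in (ω₀ - ρ)..(ω₀ + ρ), gaussianPDFReal ω v x := fun s hs => by
    rw [truncDensity_normalSignal hv hs hρ, mul_div_assoc]
  rw [setIntegral_congr_fun (measurableSet_signalRange _ _) hcongr,
    setIntegral_signalRange_ofReal hρ.le, intervalIntegral.integral_div,
    div_lt_iff₀ (intervalIntegral_gaussianPDFReal_pos hv ω hpq)]
  exact intervalIntegral_affine_sq_mul_lt hv ω hpq _

lemma integral_information_bound_mul_prior (hv₀ : v₀ ≠ 0) (ω₀ : ℝ) (c : ℝ) :
    Integrable (fun ω => (((ω - ω₀) / v₀) ^ 2 + c) * gaussianPDFReal ω₀ v₀ ω) ∧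
      ∫ ω, (((ω - ω₀) / v₀) ^ 2 + c) * gaussianPDFReal ω₀ v₀ ω = 1 / v₀ + c := by
  have hv₀' : (v₀ : ℝ) ≠ 0 := by exact_mod_cast hv₀
  have hμ := isTamePrior_gaussianPDFReal hv₀ ω₀
  have hexpand (ω : ℝ) : (((ω - ω₀) / v₀) ^ 2 + c) * gaussianPDFReal ω₀ v₀ ω
      = (1 / (v₀ : ℝ) ^ 2) * ((ω - ω₀) ^ 2 * gaussianPDFReal ω₀ v₀ ω)
        + c * gaussianPDFReal ω₀ v₀ ω := by
    field_simp
  have hsq := (hμ.integrable_mul (.sub_sq ω₀)).const_mul (1 / (v₀ : ℝ) ^ 2)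
  have hconst := hμ.integrable_mul (.const c)
  simp only [hexpand]
  refine ⟨hsq.add hconst, ?_⟩
  rw [integral_add hsq hconst, integral_const_mul, integral_const_mul,
    integral_sub_sq_mul_gaussianPDFReal hv₀, hμ.integral_eq_one]
  field_simp

lemma measurable_jointScore_sq_mul_jointDensity (hv₀ : v₀ ≠ 0) (hv : v ≠ 0) (hρ : 0 < ρ)
    (ω₀ : ℝ) :
    Measurable fun p : ℝ × ℝ => jointScore ω₀ v₀ v ρ p.1 p.2 ^ 2 * jointDensity ω₀
      (gaussianPDFReal ω₀ v₀) (normalSignal v) (ENNReal.ofReal ρ) p.1 p.2 :=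
  ((continuous_jointScore hv hρ ω₀ v₀).measurable.pow_const 2).mul
    (measurable_jointDensity (isTamePrior_gaussianPDFReal hv₀ ω₀) (isSignalDensity_normalSignal hv))

lemma integrable_jointScore_sq_mul_jointDensity (hv₀ : v₀ ≠ 0) (hv : v ≠ 0) (hρ : 0 < ρ)
    (ω₀ : ℝ) :
    Integrable (fun p : ℝ × ℝ => jointScore ω₀ v₀ v ρ p.1 p.2 ^ 2 * jointDensity ω₀
        (gaussianPDFReal ω₀ v₀) (normalSignal v) (ENNReal.ofReal ρ) p.1 p.2)
      ((volume.restrict (signalRange ω₀ (ENNReal.ofReal ρ))).prod volume) := by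
  have hμ := isTamePrior_gaussianPDFReal hv₀ ω₀
  have hf := isSignalDensity_normalSignal hv
  have hmeas := measurable_jointScore_sq_mul_jointDensity hv₀ hv hρ ω₀
  have hnorm (s ω : ℝ) : ‖jointScore ω₀ v₀ v ρ s ω ^ 2 * jointDensity ω₀
      (gaussianPDFReal ω₀ v₀) (normalSignal v) (ENNReal.ofReal ρ) s ω‖
      = jointScore ω₀ v₀ v ρ s ω ^ 2 * truncDensity ω₀ (ENNReal.ofReal ρ) (normalSignal v) s ω
        * gaussianPDFReal ω₀ v₀ ω := by
    rw [Real.norm_of_nonneg (mul_nonneg (sq_nonneg _) (jointDensity_nonneg hμ hf _ s ω)),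
      jointDensity, mul_assoc]
  rw [integrable_prod_iff' hmeas.aestronglyMeasurable]
  refine ⟨ae_of_all _ fun ω => ?_, ?_⟩
  · simp only [jointDensity, ← mul_assoc]
    exact (integrableOn_jointScore_sq_mul_truncDensity hv hρ ω₀ v₀ ω).mul_const _
  have houter := hmeas.norm.stronglyMeasurable.integral_prod_left'
    (μ := volume.restrict (signalRange ω₀ (ENNReal.ofReal ρ)))
  refine (integral_information_bound_mul_prior hv₀ ω₀ (1 / v)).1.mono'
    houter.aestronglyMeasurable (ae_of_all _ fun ω => ?_)
  rw [Real.norm_of_nonneg (integral_nonneg fun s => norm_nonneg _)]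
  simp only [hnorm, integral_mul_const]
  exact mul_le_mul_of_nonneg_right
    (setIntegral_jointScore_sq_mul_truncDensity_lt hv hρ ω₀ v₀ ω).le (hμ.pos ω).le

lemma integral_jointScore_sq_mul_jointDensity_lt (hv₀ : v₀ ≠ 0) (hv : v ≠ 0) (hρ : 0 < ρ)
    (ω₀ : ℝ) :
    ∫ s in signalRange ω₀ (ENNReal.ofReal ρ), ∫ ω, jointScore ω₀ v₀ v ρ s ω ^ 2 * jointDensity ω₀
      (gaussianPDFReal ω₀ v₀) (normalSignal v) (ENNReal.ofReal ρ) s ω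
      < 1 / v₀ + 1 / v := by
  have hμ := isTamePrior_gaussianPDFReal hv₀ ω₀
  have hint := integrable_jointScore_sq_mul_jointDensity hv₀ hv hρ ω₀
  obtain ⟨hbound, hbound_eq⟩ := integral_information_bound_mul_prior hv₀ ω₀ (1 / v)
  rw [integral_integral_swap hint, ← hbound_eq]
  refine integral_lt_integral_of_lt hint.integral_prod_right hbound fun ω => ?_
  simp only [jointDensity, ← mul_assoc, integral_mul_const]
  exact mul_lt_mul_of_pos_right
    (setIntegral_jointScore_sq_mul_truncDensity_lt hv hρ ω₀ v₀ ω) (hμ.pos ω)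

lemma ofReal_lt_expectedLoss_ofReal (hv₀ : v₀ ≠ 0) (hv : v ≠ 0) (hρ : 0 < ρ) (ω₀ : ℝ) :
    ENNReal.ofReal (v₀ * v / (v₀ + v)) < expectedLoss ω₀ (gaussianPDFReal ω₀ v₀)
      (normalSignal v) (ENNReal.ofReal ρ) := by
  have : (0 : ℝ) < v := by exact_mod_cast pos_iff_ne_zero.2 hv
  have : (0 : ℝ) < v₀ := by exact_mod_cast pos_iff_ne_zero.2 hv₀
  have hμ := isTamePrior_gaussianPDFReal hv₀ ω₀
  have hf := isSignalDensity_normalSignal hv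
  have hr : ENNReal.ofReal ρ ≠ 0 := by simpa using hρ
  have hinfo := integral_jointScore_sq_mul_jointDensity_lt hv₀ hv hρ ω₀
  have hcramerRao := ofReal_le_lintegral_lintegral_sub_sq_mul_of_score
    (jointDensity_nonneg hμ hf _)
    (ae_restrict_of_forall_mem (measurableSet_signalRange _ _)
      fun s hs ω => hasDerivAt_jointDensity hv₀ hv hρ hs ω)
    (integrable_jointDensity_prod hμ hf hr)
    (integrable_jointScore_sq_mul_jointDensity hv₀ hv hρ ω₀)
    (fun s => action ω₀ (gaussianPDFReal ω₀ v₀) (normalSignal v) s (ENNReal.ofReal ρ))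
    (v₀ * v / (v₀ + v))
  rw [integral_integral_jointDensity hμ hf hr] at hcramerRao
  rw [expectedLoss_eq_lintegral hμ hf hr]
  refine lt_of_lt_of_le ?_ (hcramerRao.trans (setLIntegral_le_lintegral _ _))
  set k : ℝ := v₀ * v / (v₀ + v) with hk_def
  have hk : 0 < k := by positivity
  have hk_inv : k * (1 / v₀ + 1 / v) = 1 := by
    rw [hk_def]
    field_simp
    ring
  refine (ENNReal.ofReal_lt_ofReal_iff_of_nonneg hk.le).2 ?_
  have := mul_lt_mul_of_pos_left hinfo (pow_pos hk 2)
  nlinarith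

end CramerRao

section SingleQuality

variable {v₀ v : ℝ≥0} {r : ℝ≥0∞}

lemma ofReal_lt_expectedLoss_normalSignal (hv₀ : v₀ ≠ 0) (hv : v ≠ 0) (ω₀ : ℝ)
    (hr : r ≠ ⊤) : ENNReal.ofReal (v₀ * v / (v₀ + v)) <
      expectedLoss ω₀ (gaussianPDFReal ω₀ v₀) (normalSignal v) r := by
  have : (0 : ℝ) < v := by exact_mod_cast pos_iff_ne_zero.2 hv
  have hv₀' : (0 : ℝ) < v₀ := by exact_mod_cast pos_iff_ne_zero.2 hv₀
  have hμ := isTamePrior_gaussianPDFReal hv₀ ω₀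
  rcases eq_or_ne r 0 with rfl | hr0
  · rw [expectedLoss_zero hμ, ← ofReal_integral_eq_lintegral_ofReal
      (hμ.integrable_mul (.sub_sq ω₀))
      (ae_of_all _ fun ω => mul_nonneg (sq_nonneg _) (hμ.pos ω).le),
      integral_sub_sq_mul_gaussianPDFReal hv₀]
    refine (ENNReal.ofReal_lt_ofReal_iff hv₀').2 ((div_lt_iff₀ (by positivity)).2 ?_)
    nlinarith
  · rw [← ENNReal.ofReal_toReal hr]
    exact ofReal_lt_expectedLoss_ofReal hv₀ hv (ENNReal.toReal_pos hr0 hr) ω₀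

-- `v₀ / (v₀ + v)` is the weight on the signal in the posterior mean.
lemma loss_of_posterior_weight (hv₀ : v₀ ≠ 0) :
    (1 - v₀ / (v₀ + v) : ℝ) ^ 2 * v₀ + (v₀ / (v₀ + v) : ℝ) ^ 2 * v = v₀ * v / (v₀ + v) := by
  have : (0 : ℝ) < v₀ := by exact_mod_cast pos_iff_ne_zero.2 hv₀
  have hsum : (v₀ + v : ℝ) ≠ 0 := by positivity
  field_simp
  ring

lemma expectedLoss_top_lt_expectedLoss (hv₀ : v₀ ≠ 0) (hv : v ≠ 0) (ω₀ : ℝ) (hr : r ≠ ⊤) :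
    expectedLoss ω₀ (gaussianPDFReal ω₀ v₀) (normalSignal v) ⊤
      < expectedLoss ω₀ (gaussianPDFReal ω₀ v₀) (normalSignal v) r := by
  have hv' : (0 : ℝ) < v := by exact_mod_cast pos_iff_ne_zero.2 hv
  refine lt_of_le_of_lt ?_ (ofReal_lt_expectedLoss_normalSignal hv₀ hv ω₀ hr)
  rw [← loss_of_posterior_weight hv₀, ← integral_sub_sq_mul_gaussianPDFReal hv₀ ω₀]
  exact (hasErrorVariance_normalSignal hv).expectedLoss_top_le
    (isTamePrior_gaussianPDFReal hv₀ ω₀) (isSignalDensity_normalSignal hv)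
    (expComparable_normalSignal hv' le_rfl ω₀) _

end SingleQuality

section OptimalRadii

variable {ι : Type*} {l : Filter ι} {ω₀ κ : ℝ} {μ₀ : ℝ → ℝ} {F : ι → ℝ → ℝ → ℝ}
  {f : ℝ → ℝ → ℝ} {r : ι → ℝ≥0∞} {v₀ v : ℝ≥0}

lemma lowerSemicontinuous_expectedLoss (hμ : IsTamePrior ω₀ μ₀) (hf : IsSignalDensity f)
    (hκ : ExpComparable ω₀ κ f) : LowerSemicontinuous (expectedLoss ω₀ μ₀ f) :=
  lowerSemicontinuous_iff_le_liminf.2 fun _ => expectedLoss_le_liminf hμ (fun _ => hf) hf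
    (.of_forall fun _ => hκ) (fun _ _ => tendsto_const_nhds) tendsto_id

lemma exists_forall_expectedLoss_le (hμ : IsTamePrior ω₀ μ₀) (hf : IsSignalDensity f)
    (hκ : ExpComparable ω₀ κ f) :
    ∃ r, ∀ r', expectedLoss ω₀ μ₀ f r ≤ expectedLoss ω₀ μ₀ f r' := by
  obtain ⟨r, -, hr⟩ := ((lowerSemicontinuous_expectedLoss hμ hf hκ).lowerSemicontinuousOn
    Set.univ).exists_isMinOn Set.univ_nonempty isCompact_univ
  exact ⟨r, fun r' => hr (Set.mem_univ r')⟩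

-- By lower semicontinuity, the limit loss at a cluster point of the radii is at most `C'`.
lemma tendsto_radius_of_expectedLoss_le [l.IsCountablyGenerated] {r₀ : ℝ≥0∞} {C : ι → ℝ≥0∞}
    {C' : ℝ≥0∞} (hμ : IsTamePrior ω₀ μ₀) (hF : ∀ i, IsSignalDensity (F i)) (hf : IsSignalDensity f)
    (hκ : ∀ᶠ i in l, ExpComparable ω₀ κ (F i))
    (hlim : ∀ s ω, Tendsto (fun i => F i s ω) l (𝓝 (f s ω)))
    (hle : ∀ᶠ i in l, expectedLoss ω₀ μ₀ (F i) (r i) ≤ C i) (hC : Tendsto C l (𝓝 C'))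
    (hlt : ∀ r' ≠ r₀, C' < expectedLoss ω₀ μ₀ f r') : Tendsto r l (𝓝 r₀) := by
  refine tendsto_nhds_of_unique_mapClusterPt fun r' hr' => ?_
  by_contra hne
  have : (l ⊓ comap r (𝓝 r')).NeBot := by
    rwa [inf_comm, ← map_neBot_iff r, Filter.push_pull']
  have hsub : l ⊓ comap r (𝓝 r') ≤ l := inf_le_left
  refine (hlt r' hne).not_ge ?_
  calc expectedLoss ω₀ μ₀ f r'
      ≤ liminf (fun i => expectedLoss ω₀ μ₀ (F i) (r i)) (l ⊓ comap r (𝓝 r')) :=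
        expectedLoss_le_liminf hμ hF hf (hκ.filter_mono hsub)
          (fun s ω => (hlim s ω).mono_left hsub) (tendsto_comap.mono_left inf_le_right)
    _ ≤ liminf C (l ⊓ comap r (𝓝 r')) := liminf_le_liminf (hle.filter_mono hsub)
    _ = C' := (hC.mono_left hsub).liminf_eq

/-- Signals `F i` whose quality uncertainty vanishes along `l`: they converge, together with their
error variances, to a normal signal with variance `v`. The bound on likelihood ratios makes the
posterior moments converge as well. -/
structure TendstoNormalSignal (l : Filter ι) (ω₀ : ℝ) (F : ι → ℝ → ℝ → ℝ) (v : ℝ≥0) : Prop where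
  isSignalDensity : ∀ i, IsSignalDensity (F i)
  expComparable : ∃ κ, ∀ᶠ i in l, ExpComparable ω₀ κ (F i)
  errorVariance : ∃ q : ι → ℝ, (∀ i, HasErrorVariance (F i) (q i)) ∧ Tendsto q l (𝓝 v)
  tendsto : ∀ s ω, Tendsto (fun i => F i s ω) l (𝓝 (normalSignal v s ω))

variable [l.IsCountablyGenerated]

lemma TendstoNormalSignal.tendsto_radius (hF : TendstoNormalSignal l ω₀ F v) (hv₀ : v₀ ≠ 0)
    (hv : v ≠ 0) (hr : ∀ i, expectedLoss ω₀ (gaussianPDFReal ω₀ v₀) (F i) (r i)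
      ≤ expectedLoss ω₀ (gaussianPDFReal ω₀ v₀) (F i) ⊤) : Tendsto r l (𝓝 ⊤) := by
  obtain ⟨κ, hκ⟩ := hF.expComparable
  obtain ⟨q, hq, hqlim⟩ := hF.errorVariance
  have hμ := isTamePrior_gaussianPDFReal hv₀ ω₀
  set c : ℝ := v₀ / (v₀ + v) with hc
  refine tendsto_radius_of_expectedLoss_le
    (C := fun i => ENNReal.ofReal ((1 - c) ^ 2 * v₀ + c ^ 2 * q i)) hμ hF.isSignalDensity
    (isSignalDensity_normalSignal hv) hκ hF.tendsto ?_
    (ENNReal.tendsto_ofReal ((hqlim.const_mul _).const_add _)) fun r' hr' => ?_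
  · filter_upwards [hκ] with i hκi
    refine (hr i).trans ?_
    rw [← integral_sub_sq_mul_gaussianPDFReal hv₀ ω₀]
    exact (hq i).expectedLoss_top_le hμ (hF.isSignalDensity i) hκi c
  · rw [hc, loss_of_posterior_weight hv₀]
    exact ofReal_lt_expectedLoss_normalSignal hv₀ hv ω₀ hr'

lemma TendstoNormalSignal.tendsto_action (hF : TendstoNormalSignal l ω₀ F v) (hv₀ : v₀ ≠ 0)
    (hv : v ≠ 0) (hr : Tendsto r l (𝓝 ⊤)) (s : ℝ) :
    Tendsto (fun i => action ω₀ (gaussianPDFReal ω₀ v₀) (F i) s (r i)) l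
      (𝓝 (v * ω₀ / (v₀ + v) + v₀ / (v₀ + v) * s)) := by
  rcases l.eq_or_neBot with rfl | _
  · exact tendsto_bot
  obtain ⟨κ, hκ⟩ := hF.expComparable
  rw [← action_top_normalSignal hv₀ hv]
  exact EchoChamber.tendsto_action (isTamePrior_gaussianPDFReal hv₀ ω₀) hF.isSignalDensity
    (isSignalDensity_normalSignal hv) hκ hF.tendsto hr (by simp)

end OptimalRadii

section NormalParams

variable {P : NormalParams}

/-- Parameters for which every density of the model is a genuine probability density. -/
structure NormalParams.IsNondegenerate (P : NormalParams) : Prop where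
  v₀_ne_zero : P.v₀ ≠ 0
  vH_ne_zero : P.vH ≠ 0
  vL_ne_zero : P.vL ≠ 0
  h_mem : P.h ∈ Set.Icc (0 : ℝ) 1

namespace NormalParams.IsNondegenerate

lemma isSignalDensity (hP : P.IsNondegenerate) : IsSignalDensity P.signal :=
  (isSignalDensity_normalSignal hP.vH_ne_zero).mix (isSignalDensity_normalSignal hP.vL_ne_zero)
    hP.h_mem

lemma expComparable (hP : P.IsNondegenerate) {u : ℝ} (hu : 0 < u) (huH : u ≤ P.vH)
    (huL : u ≤ P.vL) (ω₀ : ℝ) : ExpComparable ω₀ (2 / u) P.signal :=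
  (expComparable_normalSignal hu huH ω₀).mix (expComparable_normalSignal hu huL ω₀) hP.h_mem

lemma hasErrorVariance (hP : P.IsNondegenerate) :
    HasErrorVariance P.signal (P.h * P.vH + (1 - P.h) * P.vL) :=
  (hasErrorVariance_normalSignal hP.vH_ne_zero).mix (hasErrorVariance_normalSignal hP.vL_ne_zero) _

lemma exists_isOptimalRadius (hP : P.IsNondegenerate) : ∃ r, P.IsOptimalRadius r := by
  have hu : (0 : ℝ) < min P.vH P.vL :=
    lt_min (by exact_mod_cast pos_iff_ne_zero.2 hP.vH_ne_zero)
      (by exact_mod_cast pos_iff_ne_zero.2 hP.vL_ne_zero)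
  exact exists_forall_expectedLoss_le (isTamePrior_gaussianPDFReal hP.v₀_ne_zero P.ω₀)
    hP.isSignalDensity (hP.expComparable hu (min_le_left _ _) (min_le_right _ _) _)

lemma exists_signal_eq_normalSignal (hP : P.IsNondegenerate)
    (hq : P.vH = P.vL ∨ P.h = 0 ∨ P.h = 1) : ∃ v ≠ 0, P.signal = normalSignal v := by
  rcases hq with hv | h0 | h1
  · refine ⟨P.vL, hP.vL_ne_zero, funext₂ fun s ω => ?_⟩
    rw [signal, normalSignal, hv]
    ring
  · exact ⟨P.vL, hP.vL_ne_zero, funext₂ fun s ω => by simp [signal, normalSignal, h0]⟩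
  · exact ⟨P.vH, hP.vH_ne_zero, funext₂ fun s ω => by simp [signal, normalSignal, h1]⟩

lemma isOptimalRadius_iff_eq_top (hP : P.IsNondegenerate)
    (hq : P.vH = P.vL ∨ P.h = 0 ∨ P.h = 1) (r : ℝ≥0∞) : P.IsOptimalRadius r ↔ r = ⊤ := by
  obtain ⟨v, hv, hsignal⟩ := hP.exists_signal_eq_normalSignal hq
  have hlt (r' : ℝ≥0∞) (hr' : r' ≠ ⊤) : expectedLoss P.ω₀ P.prior P.signal ⊤
      < expectedLoss P.ω₀ P.prior P.signal r' := by
    rw [hsignal]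
    exact expectedLoss_top_lt_expectedLoss hP.v₀_ne_zero hv P.ω₀ hr'
  constructor
  · intro hr
    by_contra hne
    exact (hlt r hne).not_ge (hr ⊤)
  · rintro rfl r'
    rcases eq_or_ne r' ⊤ with rfl | hr'
    exacts [le_rfl, (hlt r' hr').le]

end NormalParams.IsNondegenerate

end NormalParams

section VanishingQualityUncertainty

variable {ι : Type*} {l : Filter ι} {vH vL : ι → ℝ≥0} {h : ι → ℝ} {vH' vL' : ℝ≥0}

/-- The quality of a signal becomes irrelevant along `l`: either both qualities become equally
precise, or one of them disappears. -/
def VanishingQualityUncertainty (l : Filter ι) (vH vL : ι → ℝ≥0) (h : ι → ℝ) : Prop :=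
  Tendsto (fun i => |(vH i : ℝ) - (vL i : ℝ)|) l (𝓝 0) ∨ Tendsto h l (𝓝 0) ∨ Tendsto h l (𝓝 1)

lemma tendsto_mix {a b : ι → ℝ} {A B C : ℝ} (ha : Tendsto a l (𝓝 A)) (hb : Tendsto b l (𝓝 B))
    (hh : ∀ i, h i ∈ Set.Icc (0 : ℝ) 1)
    (hC : (A = C ∧ B = C) ∨ (Tendsto h l (𝓝 0) ∧ B = C) ∨ (Tendsto h l (𝓝 1) ∧ A = C)) :
    Tendsto (fun i => h i * a i + (1 - h i) * b i) l (𝓝 C) := by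
  rcases hC with ⟨rfl, rfl⟩ | ⟨h0, rfl⟩ | ⟨h1, rfl⟩
  · refine (Metric.nhds_basis_ball.tendsto_right_iff).2 fun ε hε => ?_
    filter_upwards [ha (Metric.ball_mem_nhds _ hε), hb (Metric.ball_mem_nhds _ hε)] with i hai hbi
    exact convex_ball _ ε hai hbi (hh i).1 (sub_nonneg.2 (hh i).2) (add_sub_cancel _ _)
  · simpa using (h0.mul ha).add ((h0.const_sub 1).mul hb)
  · simpa using (h1.mul ha).add ((h1.const_sub 1).mul hb)

lemma VanishingQualityUncertainty.exists_isCountablyGenerated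
    (hvan : VanishingQualityUncertainty l vH vL h)
    (limH : Tendsto vH l (𝓝 vH')) (limL : Tendsto vL l (𝓝 vL')) :
    ∃ G : Filter ι, G.IsCountablyGenerated ∧ l ≤ G ∧ VanishingQualityUncertainty G vH vL h ∧
      Tendsto vH G (𝓝 vH') ∧ Tendsto vL G (𝓝 vL') := by
  have hcomap {t : ι → ℝ} {a : ℝ} (ht : Tendsto t l (𝓝 a)) :
      ∃ G : Filter ι, G.IsCountablyGenerated ∧ l ≤ G ∧ Tendsto t G (𝓝 a) ∧
        Tendsto vH G (𝓝 vH') ∧ Tendsto vL G (𝓝 vL') :=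
    ⟨comap t (𝓝 a) ⊓ (comap vH (𝓝 vH') ⊓ comap vL (𝓝 vL')), inferInstance,
      le_inf ht.le_comap (le_inf limH.le_comap limL.le_comap),
      tendsto_comap.mono_left inf_le_left,
      tendsto_comap.mono_left (inf_le_right.trans inf_le_left),
      tendsto_comap.mono_left (inf_le_right.trans inf_le_right)⟩
  rcases hvan with hd | h0 | h1
  · obtain ⟨G, hG, hle, ht, hlim⟩ := hcomap hd
    exact ⟨G, hG, hle, .inl ht, hlim⟩
  · obtain ⟨G, hG, hle, ht, hlim⟩ := hcomap h0
    exact ⟨G, hG, hle, .inr (.inl ht), hlim⟩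
  · obtain ⟨G, hG, hle, ht, hlim⟩ := hcomap h1
    exact ⟨G, hG, hle, .inr (.inr ht), hlim⟩

lemma VanishingQualityUncertainty.exists_limit_variance
    (hvan : VanishingQualityUncertainty l vH vL h)
    (hvH' : vH' ≠ 0) (hvL' : vL' ≠ 0)
    (limH : Tendsto vH l (𝓝 vH')) (limL : Tendsto vL l (𝓝 vL')) :
    ∃ v ≠ 0, (vH' = v ∧ vL' = v) ∨ (Tendsto h l (𝓝 0) ∧ vL' = v) ∨
      (Tendsto h l (𝓝 1) ∧ vH' = v) := by
  rcases l.eq_or_neBot with rfl | _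
  · exact ⟨vL', hvL', .inr (.inl ⟨tendsto_bot, rfl⟩)⟩
  rcases hvan with hd | h0 | h1
  · have hdist : Tendsto (fun i => |(vH i : ℝ) - (vL i : ℝ)|) l (𝓝 |(vH' : ℝ) - (vL' : ℝ)|) :=
      ((NNReal.tendsto_coe.2 limH).sub (NNReal.tendsto_coe.2 limL)).abs
    have heq : (vH' : ℝ) = vL' := sub_eq_zero.1 (abs_eq_zero.1 (tendsto_nhds_unique hdist hd))
    exact ⟨vL', hvL', .inl ⟨NNReal.coe_injective heq, rfl⟩⟩
  · exact ⟨vL', hvL', .inr (.inl ⟨h0, rfl⟩)⟩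
  · exact ⟨vH', hvH', .inr (.inr ⟨h1, rfl⟩)⟩

lemma tendstoNormalSignal_signal {v v₀ : ℝ≥0} {ω₀ : ℝ}
    (hP : ∀ i, (NormalParams.mk ω₀ v₀ (vH i) (vL i) (h i)).IsNondegenerate)
    (hvH' : vH' ≠ 0) (hvL' : vL' ≠ 0)
    (limH : Tendsto vH l (𝓝 vH')) (limL : Tendsto vL l (𝓝 vL'))
    (hv : (vH' = v ∧ vL' = v) ∨ (Tendsto h l (𝓝 0) ∧ vL' = v) ∨ (Tendsto h l (𝓝 1) ∧ vH' = v)) :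
    TendstoNormalSignal l ω₀ (fun i => (NormalParams.mk ω₀ v₀ (vH i) (vL i) (h i)).signal) v where
  isSignalDensity i := (hP i).isSignalDensity
  expComparable := by
    obtain ⟨u, hu, huv⟩ := exists_between (lt_min (pos_iff_ne_zero.2 hvH') (pos_iff_ne_zero.2 hvL'))
    refine ⟨2 / u, ?_⟩
    filter_upwards [limH.eventually_const_le (lt_min_iff.1 huv).1,
      limL.eventually_const_le (lt_min_iff.1 huv).2] with i hiH hiL
    exact (hP i).expComparable hu hiH hiL ω₀
  errorVariance := ⟨_, fun i => (hP i).hasErrorVariance,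
    tendsto_mix (NNReal.tendsto_coe.2 limH) (NNReal.tendsto_coe.2 limL) (fun i => (hP i).h_mem)
      (by simpa only [NNReal.coe_inj] using hv)⟩
  tendsto s ω := tendsto_mix (tendsto_gaussianPDFReal hvH' limH ω s)
    (tendsto_gaussianPDFReal hvL' limL ω s) (fun i => (hP i).h_mem)
    (hv.imp (fun h => by simp [h.1, h.2, normalSignal]) (Or.imp
      (fun h => ⟨h.1, by rw [h.2, normalSignal]⟩) fun h => ⟨h.1, by rw [h.2, normalSignal]⟩))

end VanishingQualityUncertainty

end EchoChamber

end

theorem mainTheorem5 {ι : Type*} {l : Filter ι}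
    (ω₀ : ℝ) (v₀ : ℝ≥0) (hv₀ : 0 < v₀)
    (vH vL : ι → ℝ≥0) (h : ι → ℝ)
    (hvH : ∀ i, 0 < vH i) (hvL : ∀ i, 0 < vL i) (hh : ∀ i, h i ∈ Set.Icc (0 : ℝ) 1)
    (vH' vL' : ℝ≥0) (hvH' : 0 < vH') (hvL' : 0 < vL')
    (limH : Tendsto vH l (𝓝 vH')) (limL : Tendsto vL l (𝓝 vL'))
    (hlim : Tendsto (fun i => |(vH i : ℝ) - (vL i : ℝ)|) l (𝓝 0) ∨
      Tendsto h l (𝓝 0) ∨ Tendsto h l (𝓝 1)) :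
    -- an optimal radius exists
    (∀ i, ∃ r : ℝ≥0∞, (EchoChamber.NormalParams.mk ω₀ v₀ (vH i) (vL i) (h i)).IsOptimalRadius r) ∧
    -- optimal radii tend to infinity, and the action tends to an increasing linear function of `s`
    (∃ b c : ℝ, 0 < c ∧
      (∀ rstar : ι → ℝ≥0∞,
        (∀ i, (EchoChamber.NormalParams.mk ω₀ v₀ (vH i) (vL i) (h i)).IsOptimalRadius (rstar i)) →
        Tendsto rstar l (𝓝 ⊤) ∧
        ∀ s : ℝ, Tendsto
          (fun i => (EchoChamber.NormalParams.mk ω₀ v₀ (vH i) (vL i) (h i)).optAction s (rstar i))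
          l (𝓝 (b + c * s))) ∧
      ∀ s : ℝ, Tendsto
        (fun i => (EchoChamber.NormalParams.mk ω₀ v₀ (vH i) (vL i) (h i)).optAction s ⊤)
        l (𝓝 (b + c * s))) ∧
    -- without quality uncertainty, not censoring is the only optimum
    (∀ i, (vH i = vL i ∨ h i = 0 ∨ h i = 1) → ∀ r : ℝ≥0∞,
      (EchoChamber.NormalParams.mk ω₀ v₀ (vH i) (vL i) (h i)).IsOptimalRadius r ↔ r = ⊤) := by
  have hP i : (EchoChamber.NormalParams.mk ω₀ v₀ (vH i) (vL i) (h i)).IsNondegenerate :=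
    ⟨hv₀.ne', (hvH i).ne', (hvL i).ne', hh i⟩
  obtain ⟨G, _, hlG, hvan, limH, limL⟩ :=
    EchoChamber.VanishingQualityUncertainty.exists_isCountablyGenerated hlim limH limL
  obtain ⟨v, hv, hv_eq⟩ := hvan.exists_limit_variance hvH'.ne' hvL'.ne' limH limL
  have hF := EchoChamber.tendstoNormalSignal_signal hP hvH'.ne' hvL'.ne' limH limL hv_eq
  refine ⟨fun i => (hP i).exists_isOptimalRadius,
    ⟨v * ω₀ / (v₀ + v), v₀ / (v₀ + v), by positivity, fun rstar hr => ?_, fun s => ?_⟩,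
    fun i => (hP i).isOptimalRadius_iff_eq_top⟩
  · have hr_top : Tendsto rstar G (𝓝 ⊤) := hF.tendsto_radius hv₀.ne' hv fun i => hr i ⊤
    exact ⟨hr_top.mono_left hlG,
      fun s => (hF.tendsto_action hv₀.ne' hv hr_top s).mono_left hlG⟩
  · exact (hF.tendsto_action hv₀.ne' hv tendsto_const_nhds s).mono_left hlG
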